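/- Let $Z\subset\mathbb R^3$ be a bounded open set with smooth two-dimensional boundary $\partial Z$ (locally $Z=\{\rho<0\}$ with $\rho$ smooth, $\nabla\rho\neq0$), where $\partial Z$ carries the boundary orientation (outward normal first). Let $\epsilon,\mu,\sigma:\overline Z\to\mathbb R$ and $\sigma_d:\partial Z\to\mathbb R$ be continuous, time-independent functions with $\epsilon,\mu>0$, $\sigma\ge0$, $\sigma_d\ge 0$. Let $I\subset\mathbb R$ be an open interval. Consider time-dependent one-forms $\mathcal H,\mathcal E$ on $\overline Z$, of class $C^2$ on $I\times\overline Z$, and a time-dependent one-form $J^s$ on $\partial Z$, satisfying for all $t\in I$ Maxwell's equations with resistive boundary condition $$-\mu\,\mathcal H_t=\ast d\mathcal E,\qquad \epsilon\,\mathcal E_t=-\sigma\mathcal E+\ast d\mathcal H\quad\text{in }Z,\qquad 0=-(\mathcal H+\ast\sigma_d\mathcal E)|_{\partial Z}+J^s\quad\text{on }\partial Z .$$ Here $\ast$ in the first two equations is the Hodge star of oriented Euclidean $\mathbb R^3$. In the boundary condition $\mathcal H$ and $\mathcal E$ are restricted (pulled back) to $\partial Z$, and $\ast$ is the Hodge star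 on one-forms of $\partial Z$ normalised by $(\ast\alpha)\wedge\beta=\langle\alpha,\beta\rangle\,dA$, where $dA$ is the area form of the boundary orientation (equivalently, the star given by $\alpha\wedge\ast\beta=\langle\alpha,\beta\rangle\,dA'$ for the inward orientation $dA'=-dA$). Put $$S(\mathcal H_t,\mathcal E_t)=\tfrac12\int_Z\bigl(\mathcal H_t\wedge\ast\mu\mathcal H_t+\mathcal E_t\wedge\ast\epsilon\mathcal E_t\bigr).$$ Then this system is passive with storage function $S$ and port variables $\tfrac{d}{dt}J^s$ (input) and $\mathcal E_t|_{\partial Z}$ (output). That is, along every solution as above: the time derivative $\tfrac{d}{dt}J^s$ exists at every point of $\partial Z$ and every time in $I$; the integrands of $S$ and of $\int_{\partial Z}\tfrac{d}{dt}J^s\wedge\mathcal E_t$ are integrable; $S\ge0$; the function $t\mapsto S(\mathcal H_t,\mathcal E_t)$ is differentiable on $I$ with $$\frac{d}{dt}S(\mathcal H_t,\mathcal E_t)\le\int_{\partial Z}\frac{d}{dt}J^s\wedge\mathcal E_t ;$$ and for all $t_0\le t_1$ in $I$ the right-hand side is integrable over $[t_0,t_1]$ and $$S\big|_{t=t_1}-S\big|_{t=t_0}\le\int_{t_0}^{t_1}\!\int_{\partial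 Z}\frac{d}{dt}J^s\wedge\mathcal E_t\,dt .$$ -/

import Mathlib

open Set MeasureTheory Topology
open scoped ContDiff

noncomputable section

namespace MaxwellBoundary

/-- Oriented Euclidean space `ℝ³`. -/
abbrev E3 : Type := EuclideanSpace ℝ (Fin 3)

section Algebra

variable {V : Type*} [NormedAddCommGroup V] [InnerProductSpace ℝ V]

/-- The wedge product of alternating forms, normalised as a sum over shuffles, so that for
one-forms `(α ∧ β)(v, w) = α v * β w - α w * β v`. -/
def wedge {k l : ℕ} (α : V [⋀^Fin k]→L[ℝ] ℝ) (β : V [⋀^Fin l]→L[ℝ] ℝ) :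
    V [⋀^Fin (k + l)]→ₗ[ℝ] ℝ :=
  ((LinearMap.mul' ℝ ℝ).compAlternatingMap
    (α.toAlternatingMap.domCoprod β.toAlternatingMap)).domDomCongr finSumFinEquiv

/-- Insert the vectors `v 0, …, v (k - 1)` (in this order) into the first `k` slots of a form. -/
def contract : (k : ℕ) → {m : ℕ} → (Fin k → V) → V [⋀^Fin (m + k)]→L[ℝ] ℝ → V [⋀^Fin m]→L[ℝ] ℝ
  | 0, _, _, θ => θ
  | k + 1, _, v, θ => contract k (Fin.tail v) (θ.curryLeft (v 0))

/-- The Hodge star of a `k`-form with respect to the volume form `vol` of an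
`(m + k)`-dimensional oriented Euclidean space with orthonormal basis `b` (of either orientation;
the result does not depend on `b`):
`(∗θ)(w) = (1 / k!) ∑ θ(b_{i₁}, …, b_{iₖ}) vol(b_{i₁}, …, b_{iₖ}, w)`.
This is the star characterised by `α ∧ ∗θ = ⟨α, θ⟩ vol`. -/
def hodgeStar {ι : Type*} [Fintype ι] (b : OrthonormalBasis ι ℝ V) {k m : ℕ}
    (vol : V [⋀^Fin (m + k)]→L[ℝ] ℝ) (θ : V [⋀^Fin k]→L[ℝ] ℝ) : V [⋀^Fin m]→L[ℝ] ℝ :=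
  (k.factorial : ℝ)⁻¹ • ∑ s : Fin k → ι, θ (b ∘ s) • contract k (b ∘ s) vol

/-- The coefficient `c` of a top-degree form `η = c • vol`, where `vol` is the volume form of an
`n`-dimensional oriented Euclidean space with orthonormal basis `b` (of either orientation; the
result does not depend on `b`). -/
def topCoeff {ι : Type*} [Fintype ι] (b : OrthonormalBasis ι ℝ V) {n : ℕ}
    (vol : V [⋀^Fin n]→L[ℝ] ℝ) (η : V [⋀^Fin n]→ₗ[ℝ] ℝ) : ℝ :=
  (n.factorial : ℝ)⁻¹ * ∑ s : Fin n → ι, η (b ∘ s) * vol (b ∘ s)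

end Algebra

section Space

/-- Values of differential `k`-forms on `ℝ³`. -/
abbrev Cov (k : ℕ) : Type := E3 [⋀^Fin k]→L[ℝ] ℝ

/-- The standard volume form `dz₁ ∧ dz₂ ∧ dz₃` of `ℝ³`. -/
def vol3 : Cov 3 where
  toMultilinearMap := (EuclideanSpace.basisFun (Fin 3) ℝ).toBasis.det.toMultilinearMap
  map_eq_zero_of_eq' := (EuclideanSpace.basisFun (Fin 3) ℝ).toBasis.det.map_eq_zero_of_eq'
  cont := by
    change Continuous fun v : Fin 3 → E3 => (EuclideanSpace.basisFun (Fin 3) ℝ).toBasis.det v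
    simp only [Module.Basis.det_apply]
    refine Continuous.matrix_det (continuous_matrix fun i j => ?_)
    simp only [Module.Basis.toMatrix_apply, OrthonormalBasis.coe_toBasis_repr_apply,
      EuclideanSpace.basisFun_repr]
    fun_prop

/-- The Hodge star on `ℝ³` of a one-form; it is a two-form. -/
def star1 (α : Cov 1) : Cov 2 :=
  hodgeStar (EuclideanSpace.basisFun (Fin 3) ℝ) (k := 1) (m := 2) vol3 α

/-- The Hodge star on `ℝ³` of a two-form; it is a one-form. -/
def star2 (θ : Cov 2) : Cov 1 :=
  hodgeStar (EuclideanSpace.basisFun (Fin 3) ℝ) (k := 2) (m := 1) vol3 θ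

/-- The coefficient of a three-form on `ℝ³` with respect to `dz₁ ∧ dz₂ ∧ dz₃`; the integral of a
three-form over an open set is the Lebesgue integral of this coefficient. -/
def coeff3 (η : E3 [⋀^Fin 3]→ₗ[ℝ] ℝ) : ℝ :=
  topCoeff (EuclideanSpace.basisFun (Fin 3) ℝ) vol3 η

end Space

section Domain

/-- `ρ` is a smooth defining function of `Z` on the open neighbourhood `U` of the point `p`. -/
structure IsLocalDefiningFunction (Z : Set E3) (p : E3) (U : Set E3) (ρ : E3 → ℝ) : Prop where
  isOpen : IsOpen U
  mem : p ∈ U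
  smooth : ContDiffOn ℝ ∞ ρ U
  gradient_ne_zero : gradient ρ p ≠ 0
  mem_iff : ∀ x ∈ U, x ∈ Z ↔ ρ x < 0

/-- Bounded open subsets of `ℝ³` with smooth two-dimensional boundary, lying locally on one side
of the boundary. -/
structure IsSmoothBoundedDomain (Z : Set E3) : Prop where
  isOpen : IsOpen Z
  isBounded : Bornology.IsBounded Z
  smooth_boundary : ∀ p ∈ frontier Z, ∃ U ρ, IsLocalDefiningFunction Z p U ρ

open Classical in
/-- The outward unit normal of `Z` at a boundary point `p`: the normalised gradient of any local
defining function (the result does not depend on which one; the value is `0` if there is none). -/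
def outwardNormal (Z : Set E3) (p : E3) : E3 :=
  if h : ∃ ρ U, IsLocalDefiningFunction Z p U ρ then
    ‖gradient h.choose p‖⁻¹ • gradient h.choose p
  else 0

/-- The tangent plane `T_p ∂Z` at a boundary point `p`. -/
abbrev tangentPlane (Z : Set E3) (p : E3) : Submodule ℝ E3 :=
  (ℝ ∙ outwardNormal Z p)ᗮ

/-- Differential `k`-forms on the surface `∂Z` (only the values at boundary points matter). -/
abbrev BoundaryForm (Z : Set E3) (k : ℕ) : Type :=
  (p : E3) → tangentPlane Z p [⋀^Fin k]→L[ℝ] ℝ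

/-- Restriction (pullback along the inclusion) to `∂Z` of the value of a form at the boundary
point `p`. -/
def restrictBoundary (Z : Set E3) (p : E3) {k : ℕ} (θ : Cov k) :
    tangentPlane Z p [⋀^Fin k]→L[ℝ] ℝ :=
  θ.compContinuousLinearMap (tangentPlane Z p).subtypeL

/-- The area form of `∂Z` for the boundary orientation (outward normal first), which is the
orientation of Stokes' theorem. -/
def areaForm (Z : Set E3) : BoundaryForm Z 2 := fun p =>
  restrictBoundary Z p (vol3.curryLeft (outwardNormal Z p))

/-- The Hodge star on one-forms of `∂Z` that enters the resistive boundary condition. It is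
normalised by `(∗α) ∧ β = ⟨α, β⟩ dA`, where `dA` is the area form of the boundary orientation
(outward normal first). Equivalently, it is the star characterised by
`α ∧ ∗β = ⟨α, β⟩ dA'` for the opposite (inward) orientation `dA' = -dA`. -/
def boundaryStar (Z : Set E3) (p : E3) (α : tangentPlane Z p [⋀^Fin 1]→L[ℝ] ℝ) :
    tangentPlane Z p [⋀^Fin 1]→L[ℝ] ℝ :=
  hodgeStar (stdOrthonormalBasis ℝ (tangentPlane Z p)) (k := 1) (m := 1) (-areaForm Z p) α

/-- The density, with respect to surface area, of the two-form `α ∧ β` on `∂Z` with the boundary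
orientation. -/
def boundaryDensity (Z : Set E3) (α β : BoundaryForm Z 1) (p : E3) : ℝ :=
  topCoeff (stdOrthonormalBasis ℝ (tangentPlane Z p)) (areaForm Z p) (wedge (α p) (β p))

/-- The power pairing `∫_{∂Z} α ∧ β` of one-forms on `∂Z` with the boundary orientation. -/
def boundaryPairing (Z : Set E3) (α β : BoundaryForm Z 1) : ℝ :=
  ∫ p in frontier Z, boundaryDensity Z α β p ∂(Measure.euclideanHausdorffMeasure 2)

end Domain

section System

/-- A signal `(ℋ, ℰ, Jˢ)` of the boundary-controlled system: time-dependent one-forms `ℋ`, `ℰ` on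
`Z` and a time-dependent one-form `Jˢ` on `∂Z`. -/
structure Signal (Z : Set E3) where
  magnetic : ℝ → E3 → Cov 1
  electric : ℝ → E3 → Cov 1
  source : ℝ → BoundaryForm Z 1

/-- `ℋ_t` at time `t`. -/
def Signal.magneticRate {Z : Set E3} (w : Signal Z) (t : ℝ) (x : E3) : Cov 1 :=
  deriv (fun s => w.magnetic s x) t

/-- `ℰ_t` at time `t`. -/
def Signal.electricRate {Z : Set E3} (w : Signal Z) (t : ℝ) (x : E3) : Cov 1 :=
  deriv (fun s => w.electric s x) t

/-- The input port variable `dJˢ/dt` at time `t`. -/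
def Signal.sourceRate {Z : Set E3} (w : Signal Z) (t : ℝ) : BoundaryForm Z 1 :=
  fun p => deriv (fun s => w.source s p) t

/-- The output port variable `ℰ_t|_{∂Z}` at time `t`. -/
def Signal.output {Z : Set E3} (w : Signal Z) (t : ℝ) : BoundaryForm Z 1 :=
  fun p => restrictBoundary Z p (w.electricRate t p)

/-- Classical solutions, on the time interval `I`, of Maxwell's equations
`-μ ℋ_t = ∗dℰ`, `ε ℰ_t = -σ ℰ + ∗dℋ` in `Z` with the resistive boundary condition
`0 = -(ℋ + ∗σ_d ℰ)|_{∂Z} + Jˢ`; the fields are `C²` up to the boundary. -/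
structure IsMaxwellSolution (Z : Set E3) (ε μ σ σd : E3 → ℝ) (I : Set ℝ) (w : Signal Z) :
    Prop where
  contDiff_magnetic :
    ContDiffOn ℝ 2 (fun q : ℝ × E3 => w.magnetic q.1 q.2) (I ×ˢ closure Z)
  contDiff_electric :
    ContDiffOn ℝ 2 (fun q : ℝ × E3 => w.electric q.1 q.2) (I ×ˢ closure Z)
  faraday : ∀ t ∈ I, ∀ x ∈ Z,
    -(μ x • w.magneticRate t x) = star2 (extDeriv (w.electric t) x)
  ampere : ∀ t ∈ I, ∀ x ∈ Z,
    ε x • w.electricRate t x = -(σ x • w.electric t x) + star2 (extDeriv (w.magnetic t) x)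
  boundary : ∀ t ∈ I, ∀ p ∈ frontier Z,
    0 = -(restrictBoundary Z p (w.magnetic t p)
          + boundaryStar Z p (σd p • restrictBoundary Z p (w.electric t p))) + w.source t p

/-- The density `½ (h ∧ ∗μh + e ∧ ∗εe)` with respect to Lebesgue measure. -/
def storageDensity (ε μ : E3 → ℝ) (h e : E3 → Cov 1) (x : E3) : ℝ :=
  (1 / 2) * (coeff3 (wedge (h x) (star1 (μ x • h x))) + coeff3 (wedge (e x) (star1 (ε x • e x))))

/-- The functional `S(h, e) = ½ ∫_Z (h ∧ ∗μh + e ∧ ∗εe)`. -/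
def storage (Z : Set E3) (ε μ : E3 → ℝ) (h e : E3 → Cov 1) : ℝ :=
  ∫ x in Z, storageDensity ε μ h e x

/-- Passivity, on the time interval `I`, of the system with set of trajectories `B`, storage
function `S` (evaluated along trajectories), input `u`, output `y` and power pairing
`⟨u, y⟩ = pairing u y`: the storage is nonnegative, it satisfies `dS/dt ≤ ⟨u, y⟩` along all
trajectories, and the increase of the storage over a time interval is at most the energy
supplied through the port. -/
def IsPassive {W U Y : Type*} (I : Set ℝ) (B : Set W) (S : W → ℝ → ℝ) (u : W → ℝ → U)
    (y : W → ℝ → Y) (pairing : U → Y → ℝ) : Prop :=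
  ∀ w ∈ B,
    (∀ t ∈ I, 0 ≤ S w t) ∧
    (∀ t ∈ I, DifferentiableAt ℝ (S w) t ∧ deriv (S w) t ≤ pairing (u w t) (y w t)) ∧
    ∀ t₀ ∈ I, ∀ t₁ ∈ I, t₀ ≤ t₁ →
      IntervalIntegrable (fun t => pairing (u w t) (y w t)) volume t₀ t₁ ∧
      S w t₁ - S w t₀ ≤ ∫ t in t₀..t₁, pairing (u w t) (y w t)

end System

end MaxwellBoundary

end

/-! The coefficients do not depend on time, so the rates `ℋ_t`, `ℰ_t` solve Maxwell's equations
again, and `S` is their electromagnetic energy. In vector notation, with A dual to `ℋ_t` and B dual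
to `ℰ_t`, the differentiated equations are -μ A_t = curl B and ε B_t = -σ B + curl A. Pairing them
with A and B gives μ A·A_t + ε B·B_t = (B·curl A - A·curl B) - σ|B|² = div(A × B) - σ|B|²
(`IsMaxwellSolution.power_balance`). The fields are `C²`, so the rates are `C¹` up to the boundary
and the divergence theorem applies: dS/dt is the flux of A × B through `∂Z` minus the integral of
σ|B|².

On the boundary, `Jˢ` is by the boundary condition a trace of the fields, hence differentiable in
time. The density of `dJˢ/dt ∧ ℰ_t` is n·(A × B) + σ_d |B_tan|², where B_tan is the tangential part
(`boundaryDensity_resistive`). The supplied power therefore exceeds dS/dt by the integrals of σ|B|²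
and σ_d|B_tan|², both nonnegative. Integrating in time gives the second inequality.

Most of the work is the divergence theorem for a smooth bounded domain with two-dimensional
Hausdorff measure on the boundary (`HasBoundedGradient.fluxIdentity`). Near a boundary point and for
a direction v with ⟨n, v⟩ > 0, the domain lies below a graph over `vᗮ`. Fubini and the fundamental
theorem of calculus along v turn the integral of ∂_v u into an integral of u over the graph against
Lebesgue measure on the base. The graph map pushes that measure forward to ⟨n, v⟩ times surface
measure (`IsGraphBox.map_graphMap`). This is shown without parametrising by derivatives: near each
point, projection along v onto the tangent plane distorts the surface by a factor arbitrarily close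
to 1, and two measures that agree locally up to every factor above 1 are equal. Linearity in v and a
partition of unity make the identity global. -/

noncomputable section

namespace MaxwellBoundary

/-! ### Explicit formulas for the wedge product in low degree -/

section Wedge

variable {V : Type*} [NormedAddCommGroup V] [InnerProductSpace ℝ V]

-- Mathlib's `domCoprod` sums over shuffles, that is, over cosets of permutations. Multiplying by k!
-- l! makes it a sum over all permutations, which can be enumerated for small degrees.
open Equiv in
theorem wedge_apply_sum_perm {k l : ℕ} (α : V [⋀^Fin k]→L[ℝ] ℝ) (β : V [⋀^Fin l]→L[ℝ] ℝ)
    (v : Fin (k + l) → V) :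
    (k.factorial * l.factorial : ℝ) * wedge α β v =
      ∑ τ : Perm (Fin (k + l)), ((Perm.sign τ : ℤ) : ℝ) *
        (α (fun i => v (τ (Fin.castAdd l i))) * β (fun i => v (τ (Fin.natAdd k i)))) := by
  have h := congrArg (fun m => LinearMap.mul' ℝ ℝ (m (v ∘ finSumFinEquiv)))
    (MultilinearMap.domCoprod_alternization_eq α.toAlternatingMap β.toAlternatingMap)
  simp only [MultilinearMap.alternatization_apply, map_sum, AlternatingMap.smul_apply,
    Fintype.card_fin] at h
  have h2 : (k.factorial * l.factorial : ℝ) * wedge α β v =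
      LinearMap.mul' ℝ ℝ ((k.factorial * l.factorial) •
        (α.toAlternatingMap.domCoprod β.toAlternatingMap) (v ∘ finSumFinEquiv)) := by
    rw [map_nsmul]
    simp [wedge, Function.comp_def]
  rw [h2, ← h]
  refine Fintype.sum_equiv (permCongr finSumFinEquiv) _ _ fun σ => ?_
  rw [Perm.sign_permCongr, Units.smul_def, map_zsmul]
  simp [MultilinearMap.domCoprod_apply]

theorem sum_perm_fin_two (f : Equiv.Perm (Fin 2) → ℝ) :
    ∑ τ, f τ = f 1 + f (Equiv.swap 0 1) := by
  have : (Finset.univ : Finset (Equiv.Perm (Fin 2))) = {1, Equiv.swap 0 1} := by decide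
  rw [this, Finset.sum_pair (by decide)]

theorem sum_perm_fin_three (f : Equiv.Perm (Fin 3) → ℝ) :
    ∑ τ, f τ = f 1 + f (Equiv.swap 0 1) + f (Equiv.swap 0 2) + f (Equiv.swap 1 2) +
      f (Equiv.swap 0 1 * Equiv.swap 1 2) + f (Equiv.swap 1 2 * Equiv.swap 0 1) := by
  have : (Finset.univ : Finset (Equiv.Perm (Fin 3))) = {1, Equiv.swap 0 1, Equiv.swap 0 2,
      Equiv.swap 1 2, Equiv.swap 0 1 * Equiv.swap 1 2, Equiv.swap 1 2 * Equiv.swap 0 1} := by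
    decide
  rw [this]
  repeat rw [Finset.sum_insert (by decide)]
  rw [Finset.sum_singleton]
  ring

theorem wedge_one_one (α β : V [⋀^Fin 1]→L[ℝ] ℝ) (v : Fin 2 → V) :
    wedge α β v = α ![v 0] * β ![v 1] - α ![v 1] * β ![v 0] := by
  have h := wedge_apply_sum_perm α β v
  rw [sum_perm_fin_two] at h
  have e : ∀ f : Fin 1 → V, f = ![f 0] := fun f => by ext i; fin_cases i; rfl
  rw [e (fun i : Fin 1 => v (_ )), e (fun i : Fin 1 => v (_ )), e (fun i : Fin 1 => v (_ )),
    e (fun i : Fin 1 => v (_ ))] at h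
  simp at h
  rw [h]
  have h1 : (Fin.natAdd 1 (0 : Fin 1)) = (1 : Fin 2) := rfl
  ring

theorem map_pair_swap (β : V [⋀^Fin 2]→L[ℝ] ℝ) (a b : V) : β ![b, a] = -β ![a, b] := by
  have h : β (![a, b] ∘ Equiv.swap 0 1) = -β ![a, b] :=
    β.toAlternatingMap.map_swap ![a, b] (i := 0) (j := 1) (by decide)
  rw [← h]
  congr 1
  ext i; fin_cases i <;> simp

theorem wedge_one_two (α : V [⋀^Fin 1]→L[ℝ] ℝ) (β : V [⋀^Fin 2]→L[ℝ] ℝ) (v : Fin 3 → V) :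
    wedge α β v = α ![v 0] * β ![v 1, v 2] - α ![v 1] * β ![v 0, v 2] +
      α ![v 2] * β ![v 0, v 1] := by
  have h := wedge_apply_sum_perm α β v
  rw [sum_perm_fin_three] at h
  have e : ∀ f : Fin 1 → V, f = ![f 0] := fun f => by ext i; fin_cases i; rfl
  have e2 : ∀ f : Fin 2 → V, f = ![f 0, f 1] := fun f => by ext i; fin_cases i <;> rfl
  have n0 : (Fin.natAdd 1 (0 : Fin 2)) = (1 : Fin 3) := rfl
  have n1 : (Fin.natAdd 1 (1 : Fin 2)) = (2 : Fin 3) := rfl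
  have c0 : (Fin.castAdd 2 (0 : Fin 1)) = (0 : Fin 3) := rfl
  simp only [e (fun i : Fin 1 => v (_ )), e2 (fun i : Fin 2 => v (_ )), n0, n1, c0] at h
  have s0 : (Equiv.swap (0 : Fin 3) 1) 2 = 2 := by decide
  have s1 : (Equiv.swap (0 : Fin 3) 2) 1 = 1 := by decide
  have s2 : (Equiv.swap (1 : Fin 3) 2) 0 = 0 := by decide
  simp only [Equiv.Perm.one_apply, Equiv.swap_apply_left, Equiv.swap_apply_right, s0, s1, s2,
    Equiv.Perm.mul_apply, map_mul, Equiv.Perm.sign_one,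
    Equiv.Perm.sign_swap (show (0 : Fin 3) ≠ 1 by decide),
    Equiv.Perm.sign_swap (show (0 : Fin 3) ≠ 2 by decide),
    Equiv.Perm.sign_swap (show (1 : Fin 3) ≠ 2 by decide)] at h
  rw [map_pair_swap β (v 1) (v 2), map_pair_swap β (v 0) (v 2), map_pair_swap β (v 0) (v 1)] at h
  norm_num at h
  linarith

end Wedge

/-! ### Top-degree coefficients and Hodge stars in an orthonormal basis -/

section TopCoeff

variable {V : Type*} [NormedAddCommGroup V] [InnerProductSpace ℝ V]
variable {ι : Type*} [Fintype ι]

/-- Non-injective index choices kill an alternating form. Each remaining choice is a permutation of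
`e`, whose sign enters once from `η` and once from `vol` and cancels; the n! equal terms absorb the
normalising factor. -/
theorem topCoeff_eq {n : ℕ} (b : OrthonormalBasis ι ℝ V) (e : Fin n ≃ ι)
    (vol : V [⋀^Fin n]→L[ℝ] ℝ) (η : V [⋀^Fin n]→ₗ[ℝ] ℝ) :
    topCoeff b vol η = η (b ∘ e) * vol (b ∘ e) := by
  classical
  have h : ∑ σ : Equiv.Perm (Fin n), η (b ∘ e) * vol (b ∘ e) =
      ∑ s : Fin n → ι, η (b ∘ s) * vol (b ∘ s) := by
    refine Fintype.sum_of_injective (fun σ : Equiv.Perm (Fin n) => (e ∘ σ : Fin n → ι)) ?_ _ _ ?_ ?_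
    · intro σ τ h
      ext i
      exact congrArg Fin.val (e.injective (congrFun h i))
    · intro s hs
      have : ¬ Function.Injective s := fun hinj => hs
        ⟨Equiv.ofBijective (e.symm ∘ s) (Finite.injective_iff_bijective.mp
          (e.symm.injective.comp hinj)), by ext i; simp⟩
      rw [η.map_eq_zero_of_not_injective _ fun h => this h.of_comp, zero_mul]
    · intro σ
      have h1 : η (b ∘ e ∘ σ) = _ := η.map_perm (b ∘ e) σ
      have h2 : vol (b ∘ e ∘ σ) = _ := vol.toAlternatingMap.map_perm (b ∘ e) σ
      rw [h1, h2]
      rcases Int.units_eq_one_or (Equiv.Perm.sign σ) with h | h <;> simp [h]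
  unfold topCoeff
  rw [← h, Finset.sum_const, Finset.card_univ, Fintype.card_perm, Fintype.card_fin,
    nsmul_eq_mul, ← mul_assoc, inv_mul_cancel₀ (by positivity), one_mul]

theorem hodgeStar_one {m : ℕ} (b : OrthonormalBasis ι ℝ V) (vol : V [⋀^Fin (m + 1)]→L[ℝ] ℝ)
    (θ : V [⋀^Fin 1]→L[ℝ] ℝ) (w : Fin m → V) :
    hodgeStar b vol θ w = ∑ i, θ ![b i] * vol (Matrix.vecCons (b i) w) := by
  unfold hodgeStar
  simp only [Nat.factorial_one, Nat.cast_one, inv_one, one_smul,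
    ContinuousAlternatingMap.sum_apply, ContinuousAlternatingMap.smul_apply, smul_eq_mul]
  refine Fintype.sum_equiv (Equiv.funUnique (Fin 1) ι) _ _ fun s => ?_
  have : (b ∘ s : Fin 1 → V) = ![b (s 0)] := by ext i; fin_cases i; rfl
  simp [this, contract]

theorem hodgeStar_two {m : ℕ} (b : OrthonormalBasis ι ℝ V) (vol : V [⋀^Fin (m + 2)]→L[ℝ] ℝ)
    (θ : V [⋀^Fin 2]→L[ℝ] ℝ) (w : Fin m → V) :
    hodgeStar b vol θ w =
      2⁻¹ * ∑ i, ∑ j, θ ![b i, b j] * vol (Matrix.vecCons (b i) (Matrix.vecCons (b j) w)) := by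
  unfold hodgeStar
  simp only [Nat.factorial_two, Nat.cast_ofNat,
    ContinuousAlternatingMap.sum_apply, ContinuousAlternatingMap.smul_apply, smul_eq_mul]
  rw [← Fintype.sum_prod_type']
  congr 1
  refine Fintype.sum_equiv (finTwoArrowEquiv ι) _ _ fun s => ?_
  have : (b ∘ s : Fin 2 → V) = ![b (s 0), b (s 1)] := by ext i; fin_cases i <;> rfl
  simp [this, contract, finTwoArrowEquiv]

end TopCoeff

/-! ### One-forms on three-space as vector fields: star, curl, determinant -/

section Space

theorem vol3_apply (u v w : E3) : vol3 ![u, v, w] =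
    u 0 * (v 1 * w 2 - v 2 * w 1) + u 1 * (v 2 * w 0 - v 0 * w 2) +
      u 2 * (v 0 * w 1 - v 1 * w 0) := by
  change (EuclideanSpace.basisFun (Fin 3) ℝ).toBasis.det ![u, v, w] = _
  rw [Module.Basis.det_apply, Matrix.det_fin_three]
  simp [Module.Basis.toMatrix_apply]
  ring

/-- The components of a one-form on `ℝ³`. -/
def component (i : Fin 3) : Cov 1 →L[ℝ] ℝ :=
  ContinuousAlternatingMap.apply ℝ E3 ℝ ![EuclideanSpace.basisFun (Fin 3) ℝ i]

theorem component_apply (i : Fin 3) (θ : Cov 1) :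
    component i θ = θ ![EuclideanSpace.basisFun (Fin 3) ℝ i] := rfl

/-- The vector field dual to a one-form. -/
def sharp (θ : Cov 1) : E3 := WithLp.toLp 2 fun i => component i θ

theorem cov_apply (θ : Cov 1) (v : E3) : θ ![v] = inner ℝ (sharp θ) v := by
  have hv := (EuclideanSpace.basisFun (Fin 3) ℝ).sum_repr v
  have h : ∀ w : E3, θ ![w] =
      (ContinuousAlternatingMap.ofSubsingleton ℝ E3 ℝ (0 : Fin 1)).symm θ w := by
    intro w
    rw [ContinuousAlternatingMap.ofSubsingleton_symm_apply_apply]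
    congr 1
    ext i; fin_cases i; rfl
  rw [h, ← hv, map_sum, hv]
  simp_rw [map_smul, ← h]
  simp [PiLp.inner_apply, sharp, component_apply]

theorem star1_apply (α : Cov 1) (v w : E3) :
    star1 α ![v, w] = ∑ i, component i α * vol3 ![EuclideanSpace.basisFun (Fin 3) ℝ i, v, w] :=
  hodgeStar_one (m := 2) (EuclideanSpace.basisFun (Fin 3) ℝ) vol3 α ![v, w]

theorem star2_apply (θ : Cov 2) (w : E3) :
    star2 θ ![w] = 2⁻¹ * ∑ i, ∑ j,
      θ ![EuclideanSpace.basisFun (Fin 3) ℝ i, EuclideanSpace.basisFun (Fin 3) ℝ j] *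
      vol3 ![EuclideanSpace.basisFun (Fin 3) ℝ i, EuclideanSpace.basisFun (Fin 3) ℝ j, w] :=
  hodgeStar_two (m := 1) (EuclideanSpace.basisFun (Fin 3) ℝ) vol3 θ ![w]

theorem coeff3_wedge_star1 (α β : Cov 1) (m : ℝ) :
    coeff3 (wedge α (star1 (m • β))) = m * ∑ i, component i α * component i β := by
  unfold coeff3
  rw [topCoeff_eq _ (Equiv.refl (Fin 3))]
  erw [wedge_one_two]
  simp only [star1_apply, Fin.sum_univ_three, Equiv.coe_refl, Function.comp_id]
  have hv : (⇑(EuclideanSpace.basisFun (Fin 3) ℝ) : Fin 3 → E3) = ![EuclideanSpace.basisFun (Fin 3) ℝ 0,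
    EuclideanSpace.basisFun (Fin 3) ℝ 1, EuclideanSpace.basisFun (Fin 3) ℝ 2] := by
    ext i; fin_cases i <;> rfl
  rw [show vol3 (EuclideanSpace.basisFun (Fin 3) ℝ) = 1 by
    rw [hv, vol3_apply]; simp]
  simp only [vol3_apply, map_smul, ← component_apply]
  simp
  ring

/-- Addition in `Fin 3` is cyclic, so `(i, i + 1, i + 2)` is always an even permutation and a single
formula without signs covers all three components. -/
theorem component_star2 (θ : Cov 2) (i : Fin 3) :
    component i (star2 θ) =
      θ ![EuclideanSpace.basisFun (Fin 3) ℝ (i + 1), EuclideanSpace.basisFun (Fin 3) ℝ (i + 2)] := by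
  rw [component_apply, star2_apply]
  simp only [Fin.sum_univ_three]
  rw [map_pair_swap θ (EuclideanSpace.basisFun (Fin 3) ℝ 0) (EuclideanSpace.basisFun (Fin 3) ℝ 1),
    map_pair_swap θ (EuclideanSpace.basisFun (Fin 3) ℝ 0) (EuclideanSpace.basisFun (Fin 3) ℝ 2),
    map_pair_swap θ (EuclideanSpace.basisFun (Fin 3) ℝ 1) (EuclideanSpace.basisFun (Fin 3) ℝ 2)]
  simp only [vol3_apply]
  fin_cases i
  · simp
    ring
  · change _ = θ ![EuclideanSpace.basisFun (Fin 3) ℝ 2, EuclideanSpace.basisFun (Fin 3) ℝ 0]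
    rw [map_pair_swap θ (EuclideanSpace.basisFun (Fin 3) ℝ 0) (EuclideanSpace.basisFun (Fin 3) ℝ 2)]
    simp
    ring
  · change _ = θ ![EuclideanSpace.basisFun (Fin 3) ℝ 0, EuclideanSpace.basisFun (Fin 3) ℝ 1]
    simp
    ring

theorem extDeriv_pair {α : E3 → Cov 1} {x : E3} (h : DifferentiableAt ℝ α x) (v w : E3) :
    extDeriv α x ![v, w] = fderiv ℝ (fun y => α y ![w]) x v - fderiv ℝ (fun y => α y ![v]) x w := by
  rw [extDeriv_apply h, Fin.sum_univ_two]
  have h0 : (Fin.removeNth 0 ![v, w] : Fin 1 → E3) = ![w] := by ext i; fin_cases i; rfl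
  have h1 : (Fin.removeNth 1 ![v, w] : Fin 1 → E3) = ![v] := by ext i; fin_cases i; rfl
  rw [h0, h1]
  simp
  ring

theorem component_curl {α : E3 → Cov 1} {x : E3} (h : DifferentiableAt ℝ α x) (i : Fin 3) :
    component i (star2 (extDeriv α x)) =
      fderiv ℝ (fun y => component (i + 2) (α y)) x (EuclideanSpace.basisFun (Fin 3) ℝ (i + 1)) -
      fderiv ℝ (fun y => component (i + 1) (α y)) x
        (EuclideanSpace.basisFun (Fin 3) ℝ (i + 2)) := by
  rw [component_star2, extDeriv_pair h]
  rfl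

/-- The product of two determinants is the determinant of the mixed Gram matrix. It lets the unknown
orientation of a tangent basis be eliminated later. -/
theorem vol3_mul_vol3 (a b c x y z : E3) : vol3 ![a, b, c] * vol3 ![x, y, z] =
    inner ℝ a x * (inner ℝ b y * inner ℝ c z - inner ℝ b z * inner ℝ c y) -
    inner ℝ a y * (inner ℝ b x * inner ℝ c z - inner ℝ b z * inner ℝ c x) +
    inner ℝ a z * (inner ℝ b x * inner ℝ c y - inner ℝ b y * inner ℝ c x) := by
  simp only [vol3_apply, PiLp.inner_apply, Fin.sum_univ_three, RCLike.inner_apply, conj_trivial]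
  ring

end Space

/-! ### Algebra of the boundary pairing in a tangent plane -/

section Boundary

variable {Z : Set E3} {p : E3}

theorem restrictBoundary_one (θ : Cov 1) (v : tangentPlane Z p) :
    restrictBoundary Z p θ ![v] = inner ℝ (sharp θ) (v : E3) := by
  rw [← cov_apply]
  change θ _ = _
  congr 1
  ext i; fin_cases i; rfl

theorem areaForm_pair (v w : tangentPlane Z p) :
    areaForm Z p ![v, w] = vol3 ![outwardNormal Z p, v, w] := by
  change vol3 _ = _
  congr 1
  ext i; fin_cases i <;> rfl

theorem finrank_tangentPlane (hn : ‖outwardNormal Z p‖ = 1) :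
    Module.finrank ℝ (tangentPlane Z p) = 2 := by
  have : Fact (Module.finrank ℝ E3 = 2 + 1) := ⟨by simp⟩
  exact Submodule.finrank_orthogonal_span_singleton fun h => by simp [h] at hn

theorem tangent_inner (v : tangentPlane Z p) : inner ℝ (outwardNormal Z p) (v : E3) = 0 :=
  Submodule.mem_orthogonal_singleton_iff_inner_right.mp v.2

variable (Z p) in
/-- The standard orthonormal basis of the tangent plane, indexed by `Fin 2`. -/
def tangentBasis (hn : ‖outwardNormal Z p‖ = 1) : OrthonormalBasis (Fin 2) ℝ (tangentPlane Z p) :=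
  (stdOrthonormalBasis ℝ (tangentPlane Z p)).reindex (finCongr (finrank_tangentPlane hn))

theorem boundaryDensity_eq (hn : ‖outwardNormal Z p‖ = 1) (α β : BoundaryForm Z 1) :
    boundaryDensity Z α β p =
      (α p ![tangentBasis Z p hn 0] * β p ![tangentBasis Z p hn 1] -
        α p ![tangentBasis Z p hn 1] * β p ![tangentBasis Z p hn 0]) *
      vol3 ![outwardNormal Z p, tangentBasis Z p hn 0, tangentBasis Z p hn 1] := by
  unfold boundaryDensity
  rw [topCoeff_eq _ (finCongr (finrank_tangentPlane hn)).symm]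
  erw [wedge_one_one]
  have hb : (stdOrthonormalBasis ℝ (tangentPlane Z p) ∘
      (finCongr (finrank_tangentPlane hn)).symm : Fin 2 → tangentPlane Z p) =
      tangentBasis Z p hn := by
    ext1 i
    simp [tangentBasis]
  rw [← areaForm_pair, hb]
  refine congrArg₂ (· * ·) rfl (congrArg _ ?_)
  ext i; fin_cases i <;> rfl

theorem boundaryStar_apply (hn : ‖outwardNormal Z p‖ = 1)
    (α : tangentPlane Z p [⋀^Fin 1]→L[ℝ] ℝ) (w : tangentPlane Z p) :
    boundaryStar Z p α ![w] = -∑ i, α ![tangentBasis Z p hn i] *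
      vol3 ![outwardNormal Z p, tangentBasis Z p hn i, w] := by
  have h := hodgeStar_one (m := 1) (stdOrthonormalBasis ℝ (tangentPlane Z p)) (-areaForm Z p) α ![w]
  refine h.trans ?_
  rw [← Finset.sum_neg_distrib]
  refine (Fintype.sum_equiv (finCongr (finrank_tangentPlane hn)) _ _ fun i => ?_)
  have hi : tangentBasis Z p hn (finCongr (finrank_tangentPlane hn) i) =
      stdOrthonormalBasis ℝ (tangentPlane Z p) i := by simp [tangentBasis]
  rw [← areaForm_pair, ← mul_neg, hi]
  rfl

/-- Pythagoras for the tangential part `k - ⟨n, k⟩ n`, which has the same inner products with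
tangent vectors as `k`. -/
theorem sum_sq_inner_tangentBasis (hn : ‖outwardNormal Z p‖ = 1) (k : E3) :
    inner ℝ k (tangentBasis Z p hn 0 : E3) ^ 2 + inner ℝ k (tangentBasis Z p hn 1 : E3) ^ 2 =
      ‖k‖ ^ 2 - inner ℝ (outwardNormal Z p) k ^ 2 := by
  set n := outwardNormal Z p
  have hx : k - inner ℝ n k • n ∈ (ℝ ∙ n)ᗮ := by
    rw [Submodule.mem_orthogonal_singleton_iff_inner_right, inner_sub_right, inner_smul_right,
      real_inner_self_eq_norm_sq, hn]
    ring
  have h := (tangentBasis Z p hn).sum_sq_norm_inner_right ⟨_, hx⟩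
  have e : ∀ i, inner ℝ (tangentBasis Z p hn i) (⟨_, hx⟩ : tangentPlane Z p) =
      inner ℝ k (tangentBasis Z p hn i : E3) := by
    intro i
    rw [Submodule.coe_inner, inner_sub_right, inner_smul_right, real_inner_comm n,
      tangent_inner, real_inner_comm]
    ring
  simp only [e, Fin.sum_univ_two, Real.norm_eq_abs, sq_abs] at h
  rw [h, Submodule.coe_norm, ← real_inner_self_eq_norm_sq, ← real_inner_self_eq_norm_sq,
    inner_sub_left, inner_sub_right, inner_sub_right, inner_smul_left, inner_smul_right,
    inner_smul_left, inner_smul_right, real_inner_self_eq_norm_sq n, hn, real_inner_comm n k]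
  simp
  ring

/-- The magnetic part gives the normal component of the cross product of `h` and `k`. The resistive
part gives a nonnegative multiple of the squared tangential norm of `k` when `s ≥ 0`, because the
boundary star is normalised by `(∗α) ∧ α = |α|² dA`. -/
theorem boundaryDensity_resistive (hn : ‖outwardNormal Z p‖ = 1) (h k : Cov 1) (s : ℝ)
    (α β : BoundaryForm Z 1)
    (hα : α p = restrictBoundary Z p h + boundaryStar Z p (s • restrictBoundary Z p k))
    (hβ : β p = restrictBoundary Z p k) :
    boundaryDensity Z α β p = vol3 ![outwardNormal Z p, sharp h, sharp k] +
      s * (‖sharp k‖ ^ 2 - inner ℝ (outwardNormal Z p) (sharp k) ^ 2) := by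
  rw [boundaryDensity_eq hn, hα, hβ, ← sum_sq_inner_tangentBasis hn]
  simp only [ContinuousAlternatingMap.add_apply, boundaryStar_apply hn, Fin.sum_univ_two,
    ContinuousAlternatingMap.smul_apply, smul_eq_mul, restrictBoundary_one]
  set n := outwardNormal Z p
  have hc := fun i j => orthonormal_iff_ite.mp (tangentBasis Z p hn).orthonormal i j
  simp only [Submodule.coe_inner] at hc
  set c₀ : E3 := ((tangentBasis Z p hn 0 : tangentPlane Z p) : E3)
  set c₁ : E3 := ((tangentBasis Z p hn 1 : tangentPlane Z p) : E3)
  have h00 : inner ℝ c₀ c₀ = 1 := by simpa using hc 0 0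
  have h11 : inner ℝ c₁ c₁ = 1 := by simpa using hc 1 1
  have h01 : inner ℝ c₀ c₁ = 0 := by simpa using hc 0 1
  have h10 : inner ℝ c₁ c₀ = 0 := by simpa using hc 1 0
  have hn0 : inner ℝ n c₀ = 0 := tangent_inner _
  have hn1 : inner ℝ n c₁ = 0 := tangent_inner _
  have hnn : inner ℝ n n = 1 := by rw [real_inner_self_eq_norm_sq, hn]; norm_num
  have hA := vol3_mul_vol3 n c₀ c₁ n c₀ c₁
  rw [hnn, hn0, hn1, h00, h11, h01, h10] at hA
  have hB := vol3_mul_vol3 n (sharp h) (sharp k) n c₀ c₁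
  rw [hnn, hn0, hn1] at hB
  have z0 : vol3 ![n, c₀, c₀] = 0 := by rw [vol3_apply]; ring
  have z1 : vol3 ![n, c₁, c₁] = 0 := by rw [vol3_apply]; ring
  have z2 : vol3 ![n, c₁, c₀] = -vol3 ![n, c₀, c₁] := by rw [vol3_apply, vol3_apply]; ring
  rw [z0, z1, z2]
  set A := vol3 ![n, c₀, c₁]
  -- The basis may have either orientation, so only `A * A = 1` is known (this is `hA`). The area
  -- form contributes one factor `A` and the star another; `hB` expresses the wedge of the
  -- tangential parts as `A` times the triple product.
  linear_combination (-A) * hB + (vol3 ![n, sharp h, sharp k] +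
    s * (inner ℝ (sharp k) c₀ ^ 2 + inner ℝ (sharp k) c₁ ^ 2)) * hA

end Boundary

/-! ### Comparing measures locally, and Hausdorff measure under Lipschitz maps -/

section MeasureComparison

open scoped ENNReal NNReal

/-- By second countability, countably many of the open sets cover `S`. Making them disjoint and
using countable additivity globalises the bound, with no finiteness assumption on either measure. -/
theorem measure_le_smul_of_locally {X : Type*} [TopologicalSpace X] [SecondCountableTopology X]
    [MeasurableSpace X] [BorelSpace X] {μ ν : Measure X} {S : Set X} (hS : MeasurableSet S)
    (hμ : μ Sᶜ = 0) {κ : ℝ≥0∞}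
    (h : ∀ x ∈ S, ∃ O, IsOpen O ∧ x ∈ O ∧ ∀ A, A ⊆ O ∩ S → MeasurableSet A → μ A ≤ κ * ν A) :
    μ ≤ κ • ν := by
  choose! O hO hxO hle using h
  obtain ⟨t, htS, htc, hcov⟩ := TopologicalSpace.countable_cover_nhdsWithin
    (f := O) (s := S) fun x hx => mem_nhdsWithin_of_mem_nhds ((hO x hx).mem_nhds (hxO x hx))
  refine Measure.le_iff.2 fun A hA => ?_
  have hAS : μ A = μ (A ∩ S) := by
    refine le_antisymm ?_ (measure_mono inter_subset_left)
    calc μ A ≤ μ (A ∩ S) + μ (A \ S) := measure_le_inter_add_sdiff _ _ _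
      _ = μ (A ∩ S) := by
        rw [measure_mono_null (s := A \ S) (fun x hx => hx.2) hμ, add_zero]
  rcases t.eq_empty_or_nonempty with rfl | hne
  · have : S = ∅ := by simpa using hcov
    rw [hAS, this]
    simp
  obtain ⟨f, rfl⟩ := htc.exists_eq_range hne
  have hf : ∀ n, f n ∈ S := fun n => htS (mem_range_self n)
  have hmeas : ∀ n, MeasurableSet (disjointed (fun n => O (f n)) n) :=
    MeasurableSet.disjointed fun n => (hO _ (hf n)).measurableSet
  have hsplit : A ∩ S = ⋃ n, disjointed (fun n => O (f n)) n ∩ (A ∩ S) := by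
    rw [← iUnion_inter, iUnion_disjointed]
    refine (inter_eq_right.2 fun x hx => ?_).symm
    simpa using hcov hx.2
  have hdisj : Pairwise (Function.onFun Disjoint
      fun n => disjointed (fun n => O (f n)) n ∩ (A ∩ S)) := fun i j hij =>
    (disjoint_disjointed _ hij).mono inter_subset_left inter_subset_left
  have hm : ∀ n, MeasurableSet (disjointed (fun n => O (f n)) n ∩ (A ∩ S)) := fun n =>
    (hmeas n).inter (hA.inter hS)
  rw [hAS, Measure.smul_apply, smul_eq_mul]
  calc μ (A ∩ S) = ∑' n, μ (disjointed (fun n => O (f n)) n ∩ (A ∩ S)) := by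
        conv_lhs => rw [hsplit]
        exact measure_iUnion hdisj hm
    _ ≤ ∑' n, κ * ν (disjointed (fun n => O (f n)) n ∩ (A ∩ S)) :=
        ENNReal.tsum_le_tsum fun n => hle _ (hf n) _
          (fun x hx => ⟨disjointed_subset (fun n => O (f n)) n hx.1, hx.2.2⟩) (hm n)
    _ = κ * ν (A ∩ S) := by
        rw [ENNReal.tsum_mul_left, ← measure_iUnion hdisj hm, ← hsplit]
    _ ≤ κ * ν A := by gcongr; exact inter_subset_left

/-- The neighbourhoods may shrink as `κ` decreases to 1, since each `κ` is globalised before the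
limit is taken. -/
theorem measure_eq_of_locally {X : Type*} [TopologicalSpace X] [SecondCountableTopology X]
    [MeasurableSpace X] [BorelSpace X] {μ ν : Measure X} {S : Set X} (hS : MeasurableSet S)
    (hμ : μ Sᶜ = 0) (hν : ν Sᶜ = 0)
    (h : ∀ κ : ℝ≥0, 1 < κ → ∀ x ∈ S, ∃ O, IsOpen O ∧ x ∈ O ∧
      ∀ A, A ⊆ O ∩ S → MeasurableSet A → μ A ≤ κ * ν A ∧ ν A ≤ κ * μ A) :
    μ = ν := by
  have key : ∀ a b : ℝ≥0∞, (∀ κ : ℝ≥0, 1 < κ → a ≤ κ * b) → a ≤ b := by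
    intro a b hab
    -- Multiplication by `b` is continuous at 1 only for finite `b`; for infinite `b` there is
    -- nothing to prove.
    rcases eq_or_ne b ∞ with rfl | hb
    · exact le_top
    have ht : Filter.Tendsto (fun κ : ℝ≥0 => (κ : ℝ≥0∞) * b) (𝓝[>] 1) (𝓝 ((1 : ℝ≥0) * b)) :=
      (ENNReal.Tendsto.mul_const (ENNReal.continuous_coe.tendsto 1) (Or.inr hb)).mono_left
        nhdsWithin_le_nhds
    rw [ENNReal.coe_one, one_mul] at ht
    exact ge_of_tendsto ht (Filter.eventually_of_mem self_mem_nhdsWithin fun κ hκ => hab κ hκ)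
  refine le_antisymm (Measure.le_iff'.2 fun A => key _ _ fun κ hκ => ?_)
    (Measure.le_iff'.2 fun A => key _ _ fun κ hκ => ?_)
  · refine Measure.le_iff'.1 (measure_le_smul_of_locally (κ := κ) hS hμ fun x hx => ?_) A
    obtain ⟨O, h1, h2, h3⟩ := h κ hκ x hx
    exact ⟨O, h1, h2, fun A hA hm => (h3 A hA hm).1⟩
  · refine Measure.le_iff'.1 (measure_le_smul_of_locally (κ := κ) hS hν fun x hx => ?_) A
    obtain ⟨O, h1, h2, h3⟩ := h κ hκ x hx
    exact ⟨O, h1, h2, fun A hA hm => (h3 A hA hm).2⟩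

variable {X Y : Type*} [MetricSpace X] [MeasurableSpace X] [BorelSpace X]
  [MetricSpace Y] [MeasurableSpace Y] [BorelSpace Y]

theorem euclideanHausdorffMeasure_image_le {f : X → Y} {s : Set X} {K : ℝ≥0}
    (h : LipschitzOnWith K f s) (d : ℕ) : μHE[d] (f '' s) ≤ (K : ℝ≥0∞) ^ d * μHE[d] s := by
  simp only [Measure.euclideanHausdorffMeasure_def, Measure.smul_apply, ENNReal.smul_def,
    smul_eq_mul]
  rw [mul_left_comm]
  gcongr
  simpa using h.hausdorffMeasure_image_le (d := d) (by positivity)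

/-- The lower bound on distances makes `f` injective on `s` with a `K`-Lipschitz inverse, to which
the image bound applies. -/
theorem le_euclideanHausdorffMeasure_image {f : X → Y} {s : Set X} {K : ℝ≥0}
    (h : ∀ x ∈ s, ∀ y ∈ s, edist x y ≤ K * edist (f x) (f y)) (d : ℕ) :
    μHE[d] s ≤ (K : ℝ≥0∞) ^ d * μHE[d] (f '' s) := by
  rcases s.eq_empty_or_nonempty with rfl | hne
  · simp
  have : Nonempty X := ⟨hne.some⟩
  have hinj : InjOn f s := fun x hx y hy hxy => by simpa [hxy] using h x hx y hy
  have hl : LipschitzOnWith K (Function.invFunOn f s) (f '' s) := by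
    rintro _ ⟨x, hx, rfl⟩ _ ⟨y, hy, rfl⟩
    rw [hinj.leftInvOn_invFunOn hx, hinj.leftInvOn_invFunOn hy]
    exact h x hx y hy
  have := euclideanHausdorffMeasure_image_le hl d
  rwa [hinj.leftInvOn_invFunOn.image_image] at this

end MeasureComparison

/-! ### Area distortion between two planes -/

section Oblique

open Module

/-- The oblique section `y ↦ y - (⟨n, y⟩ / ⟨n, v⟩) v` of the orthogonal projection along `v`; it
maps `vᗮ` onto `nᗮ`. -/
def obliqueSection (n v : E3) : (ℝ ∙ v)ᗮ →ₗ[ℝ] E3 :=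
  (ℝ ∙ v)ᗮ.subtype -
    ((inner ℝ n v)⁻¹ • (innerₛₗ ℝ n ∘ₗ (ℝ ∙ v)ᗮ.subtype)).smulRight v

theorem obliqueSection_apply (n v : E3) (y : (ℝ ∙ v)ᗮ) :
    obliqueSection n v y = (y : E3) - ((inner ℝ n v)⁻¹ * inner ℝ n (y : E3)) • v := by
  simp [obliqueSection]

/-- With `c = ⟨n, v⟩` and `aᵢ = ⟨n, bᵢ⟩`, the images of the basis have Gram matrix `I + c⁻² a aᵀ`,
of determinant `1 + |a|² / c²`. Since `|a|² = 1 - c²`, this equals `c⁻²`. -/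
theorem normDet_obliqueSection {n v : E3} (hn : ‖n‖ = 1) (hv : ‖v‖ = 1) (hnv : 0 < inner ℝ n v) :
    (obliqueSection n v).normDet = (inner ℝ n v)⁻¹ := by
  have : Fact (finrank ℝ E3 = 2 + 1) := ⟨by simp⟩
  have hfin : finrank ℝ (ℝ ∙ v)ᗮ = 2 :=
    Submodule.finrank_orthogonal_span_singleton fun h => by simp [h] at hv
  set c := inner ℝ n v
  let b := (stdOrthonormalBasis ℝ (ℝ ∙ v)ᗮ).reindex (finCongr hfin)
  have hb := fun i j => orthonormal_iff_ite.mp b.orthonormal i j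
  simp only [Submodule.coe_inner] at hb
  have hbv : ∀ i, inner ℝ (b i : E3) v = 0 := fun i =>
    Submodule.mem_orthogonal_singleton_iff_inner_left.mp (b i).2
  have hvb : ∀ i, inner ℝ v (b i : E3) = 0 := fun i => by rw [real_inner_comm, hbv]
  have hx : n - c • v ∈ (ℝ ∙ v)ᗮ := by
    rw [Submodule.mem_orthogonal_singleton_iff_inner_left, inner_sub_left, inner_smul_left,
      real_inner_self_eq_norm_sq, hv]
    simp [c]
  have hsum := b.sum_sq_norm_inner_right ⟨_, hx⟩
  have e : ∀ i, inner ℝ (b i) (⟨_, hx⟩ : (ℝ ∙ v)ᗮ) = inner ℝ n (b i : E3) := fun i => by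
    rw [Submodule.coe_inner, inner_sub_right, inner_smul_right, hbv, real_inner_comm]
    ring
  simp only [e, Fin.sum_univ_two, Real.norm_eq_abs, sq_abs] at hsum
  have hnorm : ‖(⟨_, hx⟩ : (ℝ ∙ v)ᗮ)‖ ^ 2 = 1 - c ^ 2 := by
    rw [Submodule.coe_norm, ← real_inner_self_eq_norm_sq, inner_sub_left, inner_sub_right,
      inner_sub_right, inner_smul_left, inner_smul_right, inner_smul_left, inner_smul_right,
      real_inner_self_eq_norm_sq n, real_inner_self_eq_norm_sq v, hn, hv, real_inner_comm n v]
    simp [c]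
    ring
  rw [hnorm] at hsum
  have hg := (obliqueSection n v).normDet_sq_eq_det_gram b
  rw [Matrix.det_fin_two] at hg
  simp only [Matrix.gram_apply, obliqueSection_apply, inner_sub_left, inner_sub_right,
    inner_smul_left, inner_smul_right, hb, hbv, hvb, real_inner_self_eq_norm_sq v, hv] at hg
  have hc : c ≠ 0 := hnv.ne'
  have : (obliqueSection n v).normDet ^ 2 = (c⁻¹) ^ 2 := by
    simp at hg
    rw [show inner ℝ n v = c from rfl] at hg
    rw [hg]
    field_simp
    linear_combination c ^ 2 * hsum
  exact (sq_eq_sq₀ (LinearMap.normDet_nonneg _) (by positivity)).mp this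

end Oblique

/-! ### The outward normal: independence of the defining function, continuity, tangency -/

section Normal

variable {Z : Set E3} {p : E3} {U : Set E3} {ρ : E3 → ℝ}

theorem IsLocalDefiningFunction.eq_zero (h : IsLocalDefiningFunction Z p U ρ) (hZ : IsOpen Z)
    {x : E3} (hxU : x ∈ U) (hx : x ∈ frontier Z) : ρ x = 0 := by
  rw [hZ.frontier_eq] at hx
  refine le_antisymm ?_ (not_lt.mp fun hlt => hx.2 ((h.mem_iff x hxU).mpr hlt))
  have hc : ContinuousAt ρ x := h.smooth.continuousOn.continuousAt (h.isOpen.mem_nhds hxU)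
  by_contra! hpos
  obtain ⟨y, hy, hyZ⟩ := mem_closure_iff_nhds.mp hx.1 _
    (Filter.inter_mem (hc.eventually_const_lt hpos) (h.isOpen.mem_nhds hxU))
  exact absurd ((h.mem_iff y hy.2).mp hyZ) (not_lt.mpr (le_of_lt hy.1))

theorem IsLocalDefiningFunction.of_mem (h : IsLocalDefiningFunction Z p U ρ) {x : E3}
    (hxU : x ∈ U) (hx : gradient ρ x ≠ 0) : IsLocalDefiningFunction Z x U ρ :=
  ⟨h.isOpen, hxU, h.smooth, hx, h.mem_iff⟩

theorem IsLocalDefiningFunction.contDiffAt (h : IsLocalDefiningFunction Z p U ρ) {x : E3}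
    (hxU : x ∈ U) : ContDiffAt ℝ ∞ ρ x :=
  h.smooth.contDiffAt (h.isOpen.mem_nhds hxU)

theorem IsLocalDefiningFunction.differentiableAt (h : IsLocalDefiningFunction Z p U ρ) {x : E3}
    (hxU : x ∈ U) : DifferentiableAt ℝ ρ x :=
  (h.contDiffAt hxU).differentiableAt (by simp)

theorem inner_gradient {x : E3} (w : E3) : inner ℝ (gradient ρ x) w = fderiv ℝ ρ x w := by
  rw [gradient, InnerProductSpace.toDual_symm_apply]

theorem IsLocalDefiningFunction.continuousOn_gradient (h : IsLocalDefiningFunction Z p U ρ) :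
    ContinuousOn (gradient ρ) U :=
  (InnerProductSpace.toDual ℝ E3).symm.continuous.comp_continuousOn
    (h.smooth.continuousOn_fderiv_of_isOpen h.isOpen (by simp))

/-- A direction in which `ρ` decreases enters `Z`, so `ρ'` is negative along it for small positive
times, and its one-sided slopes at `p` cannot have a positive limit. -/
theorem inner_gradient_nonpos {U' : Set E3} {ρ' : E3 → ℝ} (h : IsLocalDefiningFunction Z p U ρ)
    (h' : IsLocalDefiningFunction Z p U' ρ') (h0 : ρ p = 0) (h0' : ρ' p = 0) {w : E3}
    (hw : inner ℝ (gradient ρ p) w < 0) : inner ℝ (gradient ρ' p) w ≤ 0 := by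
  have hline : HasDerivAt (fun t : ℝ => p + t • w) w 0 := by
    simpa using ((hasDerivAt_id (0 : ℝ)).smul_const w).const_add p
  have hd : ∀ {V : Set E3} {f : E3 → ℝ}, IsLocalDefiningFunction Z p V f →
      HasDerivAt (fun t : ℝ => f (p + t • w)) (inner ℝ (gradient f p) w) 0 := by
    intro V f hf
    rw [inner_gradient]
    have := (hf.differentiableAt hf.mem).hasFDerivAt
    exact HasFDerivAt.comp_hasDerivAt (0 : ℝ) (by simpa using this) hline
  have hU : ∀ {V : Set E3} {f : E3 → ℝ}, IsLocalDefiningFunction Z p V f →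
      ∀ᶠ t : ℝ in 𝓝[>] 0, p + t • w ∈ V := fun hf =>
    (hline.continuousAt.eventually_mem (by simpa using hf.isOpen.mem_nhds hf.mem)).filter_mono
      nhdsWithin_le_nhds
  have hslope := (hasDerivAt_iff_tendsto_slope.mp (hd h)).mono_left
    (nhdsWithin_mono 0 fun t (ht : t ∈ Ioi 0) => ne_of_gt ht)
  have hslope' := (hasDerivAt_iff_tendsto_slope.mp (hd h')).mono_left
    (nhdsWithin_mono 0 fun t (ht : t ∈ Ioi 0) => ne_of_gt ht)
  refine le_of_tendsto hslope' ?_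
  filter_upwards [hslope.eventually_lt_const hw, hU h, hU h', self_mem_nhdsWithin]
    with t ht hmem hmem' (hpos : 0 < t)
  simp only [slope_def_field, sub_zero, zero_smul, add_zero, h0] at ht
  have hlt : ρ (p + t • w) < 0 := by
    by_contra! hge
    exact absurd ht (not_lt.mpr (by positivity))
  have hlt' := (h'.mem_iff _ hmem').mp ((h.mem_iff _ hmem).mpr hlt)
  simp only [slope_def_field, sub_zero, zero_smul, add_zero, h0']
  exact div_nonpos_of_nonpos_of_nonneg hlt'.le hpos.le

theorem norm_inv_smul_self {w : E3} (hw : w ≠ 0) : ‖‖w‖⁻¹ • w‖ = 1 := by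
  rw [norm_smul, norm_inv, norm_norm, inv_mul_cancel₀ (norm_ne_zero_iff.mpr hw)]

/-- If two defining functions gave distinct unit normals `n` and `n'`, the direction `n' - n` would
strictly decrease the first function and strictly increase the second, contradicting
`inner_gradient_nonpos`. -/
theorem IsLocalDefiningFunction.outwardNormal_eq (h : IsLocalDefiningFunction Z p U ρ)
    (hZ : IsOpen Z) (hp : p ∈ frontier Z) :
    outwardNormal Z p = ‖gradient ρ p‖⁻¹ • gradient ρ p := by
  have hex : ∃ ρ U, IsLocalDefiningFunction Z p U ρ := ⟨ρ, U, h⟩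
  rw [outwardNormal, dif_pos hex]
  obtain ⟨U', h'⟩ := hex.choose_spec
  set ρ' := hex.choose
  set n' := ‖gradient ρ' p‖⁻¹ • gradient ρ' p with hn'
  set n := ‖gradient ρ p‖⁻¹ • gradient ρ p with hn
  have h1 : ‖n‖ = 1 := norm_inv_smul_self h.gradient_ne_zero
  have h1' : ‖n'‖ = 1 := norm_inv_smul_self h'.gradient_ne_zero
  by_contra hne
  have hlt : inner ℝ n' n < 1 := (inner_lt_one_iff_real_of_norm_eq_one h1' h1).mpr hne
  have hpos : 0 < ‖gradient ρ p‖⁻¹ := inv_pos.mpr (norm_pos_iff.mpr h.gradient_ne_zero)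
  have hpos' : 0 < ‖gradient ρ' p‖⁻¹ := inv_pos.mpr (norm_pos_iff.mpr h'.gradient_ne_zero)
  have hw : inner ℝ n (n' - n) < 0 := by
    rw [inner_sub_right, real_inner_self_eq_norm_sq, h1, real_inner_comm]
    linarith
  have hw' : 0 < inner ℝ n' (n' - n) := by
    rw [inner_sub_right, real_inner_self_eq_norm_sq, h1']
    linarith
  rw [hn, inner_smul_left] at hw
  rw [hn', inner_smul_left] at hw'
  have := inner_gradient_nonpos h h' (h.eq_zero hZ h.mem hp) (h'.eq_zero hZ h'.mem hp)
    (w := n' - n) (by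
      by_contra! hge
      exact absurd hw (not_lt.mpr (mul_nonneg hpos.le hge)))
  exact absurd hw' (not_lt.mpr (mul_nonpos_of_nonneg_of_nonpos hpos'.le this))

theorem IsSmoothBoundedDomain.norm_outwardNormal (hZ : IsSmoothBoundedDomain Z)
    (hp : p ∈ frontier Z) : ‖outwardNormal Z p‖ = 1 := by
  obtain ⟨U, ρ, h⟩ := hZ.smooth_boundary p hp
  rw [h.outwardNormal_eq hZ.isOpen hp]
  exact norm_inv_smul_self h.gradient_ne_zero

theorem IsSmoothBoundedDomain.continuousOn_outwardNormal (hZ : IsSmoothBoundedDomain Z) :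
    ContinuousOn (outwardNormal Z) (frontier Z) := by
  intro p hp
  obtain ⟨U, ρ, h⟩ := hZ.smooth_boundary p hp
  have hg : ContinuousAt (gradient ρ) p := h.continuousOn_gradient.continuousAt
    (h.isOpen.mem_nhds h.mem)
  have hc : ContinuousAt (fun x => ‖gradient ρ x‖⁻¹ • gradient ρ x) p :=
    (hg.norm.inv₀ (norm_ne_zero_iff.mpr h.gradient_ne_zero)).smul hg
  refine hc.continuousWithinAt.congr_of_eventuallyEq ?_ (h.outwardNormal_eq hZ.isOpen hp)
  filter_upwards [self_mem_nhdsWithin, mem_nhdsWithin_of_mem_nhds (h.isOpen.mem_nhds h.mem),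
    mem_nhdsWithin_of_mem_nhds (hg.eventually_ne h.gradient_ne_zero)] with x hx hxU hx0
  exact (h.of_mem hxU hx0).outwardNormal_eq hZ.isOpen hx

/-- Strict differentiability of `ρ` at `p` controls all pairs near `p` at once. Both points lie on
`ρ = 0`, so the linear term at `p` consists of error alone. -/
theorem IsSmoothBoundedDomain.exists_almost_tangent (hZ : IsSmoothBoundedDomain Z)
    (hp : p ∈ frontier Z) {δ : ℝ} (hδ : 0 < δ) :
    ∃ O, IsOpen O ∧ p ∈ O ∧ ∀ x ∈ O ∩ frontier Z, ∀ y ∈ O ∩ frontier Z,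
      |inner ℝ (outwardNormal Z p) (x - y)| ≤ δ * ‖x - y‖ := by
  obtain ⟨U, ρ, h⟩ := hZ.smooth_boundary p hp
  have hpos : 0 < ‖gradient ρ p‖ := norm_pos_iff.mpr h.gradient_ne_zero
  have hs : HasStrictFDerivAt ρ (fderiv ℝ ρ p) p :=
    (h.contDiffAt h.mem).hasStrictFDerivAt (by simp)
  obtain ⟨O, hO, hle⟩ := (hs.approximates_deriv_on_nhds
    (c := Real.toNNReal (δ * ‖gradient ρ p‖)) (Or.inr (by positivity)))
  obtain ⟨O', hO'O, hO', hpO'⟩ := mem_nhds_iff.mp (Filter.inter_mem hO (h.isOpen.mem_nhds h.mem))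
  refine ⟨O', hO', hpO', fun x hx y hy => ?_⟩
  have := hle x (hO'O hx.1).1 y (hO'O hy.1).1
  rw [h.eq_zero hZ.isOpen (hO'O hx.1).2 hx.2, h.eq_zero hZ.isOpen (hO'O hy.1).2 hy.2,
    ← inner_gradient] at this
  rw [h.outwardNormal_eq hZ.isOpen hp, inner_smul_left, abs_mul]
  simp only [sub_self, zero_sub, norm_neg, Real.norm_eq_abs,
    Real.coe_toNNReal _ (mul_pos hδ hpos).le] at this
  simp only [conj_trivial, abs_inv, abs_norm]
  rw [inv_mul_le_iff₀ hpos]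
  linarith

end Normal

/-! ### The boundary as a graph over a transversal direction -/

section Graph

variable {Z : Set E3} {p v : E3}

/-- Along lines parallel to `v` the function `ρ` is strictly increasing near `p` and changes sign,
so each line meets the boundary exactly once. Continuity of `g` is enough for what follows, so the
implicit function theorem is not needed. -/
theorem IsSmoothBoundedDomain.exists_graph (hZ : IsSmoothBoundedDomain Z) (hp : p ∈ frontier Z)
    (hv : ‖v‖ = 1) (hpos : 0 < inner ℝ (outwardNormal Z p) v) :
    ∃ δ > 0, ∃ r > 0, ∃ g : (ℝ ∙ v)ᗮ → ℝ, ContinuousOn g (Metric.ball 0 δ) ∧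
      (∀ y ∈ Metric.ball 0 δ, g y ∈ Ioo (-r) r) ∧
      (∀ y ∈ Metric.ball (0 : (ℝ ∙ v)ᗮ) δ, ∀ s ∈ Icc (-r) r, (p + y + s • v ∈ Z ↔ s < g y) ∧
        (p + y + s • v ∈ frontier Z ↔ s = g y)) ∧
      ∀ y ∈ Metric.ball (0 : (ℝ ∙ v)ᗮ) δ, ∀ s ∈ Icc (-r) r, p + y + s • v ∈ frontier Z →
        inner ℝ (outwardNormal Z p) v / 2 < inner ℝ (outwardNormal Z (p + y + s • v)) v := by
  obtain ⟨U, ρ, h⟩ := hZ.smooth_boundary p hp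
  have hgp : 0 < fderiv ℝ ρ p v := by
    rw [h.outwardNormal_eq hZ.isOpen hp, inner_smul_left, inner_gradient] at hpos
    by_contra! hle
    exact absurd hpos (not_lt.mpr (mul_nonpos_of_nonneg_of_nonpos (by simp) hle))
  have hUn := h.isOpen.mem_nhds h.mem
  have hcd : ContinuousAt (fun x => fderiv ℝ ρ x v) p :=
    ((h.smooth.continuousOn_fderiv_of_isOpen h.isOpen (by simp)).continuousAt hUn).clm_apply
      continuousAt_const
  have hcn : ∀ᶠ x in 𝓝 p, x ∈ frontier Z →
      inner ℝ (outwardNormal Z p) v / 2 < inner ℝ (outwardNormal Z x) v := by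
    rw [← eventually_nhdsWithin_iff]
    exact ((hZ.continuousOn_outwardNormal p hp).inner continuousWithinAt_const).eventually_const_lt
      (half_lt_self hpos)
  obtain ⟨η, hη, hball⟩ := Metric.eventually_nhds_iff_ball.mp
    ((Filter.eventually_mem_set.mpr hUn).and ((hcd.eventually_const_lt hgp).and hcn))
  -- Points `p + y + s • v` with `‖y‖ < r` and `|s| ≤ r` then lie within `2r < η` of `p`.
  set r := η / 3 with hr
  have hr0 : 0 < r := by positivity
  have hmem : ∀ y : (ℝ ∙ v)ᗮ, ‖y‖ < r → ∀ s ∈ Icc (-r) r, p + y + s • v ∈ Metric.ball p η := by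
    intro y hy s hs
    rw [add_assoc, mem_ball_iff_norm, add_sub_cancel_left]
    calc ‖(y : E3) + s • v‖ ≤ ‖(y : E3)‖ + ‖s • v‖ := norm_add_le _ _
      _ ≤ r + r := by
        rw [norm_smul, hv, mul_one]
        exact add_le_add hy.le (abs_le.mpr hs)
      _ < η := by rw [hr]; linarith
  have hline : ∀ (y : E3) (s : ℝ), HasDerivAt (fun s : ℝ => p + y + s • v) v s := fun y s => by
    simpa using ((hasDerivAt_id s).smul_const v).const_add (p + y)
  have hderiv : ∀ y : (ℝ ∙ v)ᗮ, ‖y‖ < r → ∀ s ∈ Icc (-r) r,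
      HasDerivAt (fun s : ℝ => ρ (p + y + s • v)) (fderiv ℝ ρ (p + y + s • v) v) s :=
    fun y hy s hs => HasFDerivAt.comp_hasDerivAt s
      (h.differentiableAt (hball _ (hmem y hy s hs)).1).hasFDerivAt (hline y s)
  have hmono : ∀ y : (ℝ ∙ v)ᗮ, ‖y‖ < r →
      StrictMonoOn (fun s : ℝ => ρ (p + y + s • v)) (Icc (-r) r) := by
    intro y hy
    refine strictMonoOn_of_deriv_pos (convex_Icc _ _)
      (fun s hs => (hderiv y hy s hs).continuousAt.continuousWithinAt) fun s hs => ?_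
    have hs' := interior_subset hs
    rw [(hderiv y hy s hs').deriv]
    exact (hball _ (hmem y hy s hs')).2.1
  have hcont : ∀ (y : (ℝ ∙ v)ᗮ), ‖y‖ < r → ∀ s ∈ Icc (-r) r,
      ContinuousAt (fun y : (ℝ ∙ v)ᗮ => ρ (p + y + s • v)) y := by
    intro y hy s hs
    have h1 : ContinuousAt (fun y : (ℝ ∙ v)ᗮ => p + (y : E3) + s • v) y := by fun_prop
    exact ContinuousAt.comp (f := fun y : (ℝ ∙ v)ᗮ => p + (y : E3) + s • v)
      (h.differentiableAt (hball _ (hmem y hy s hs)).1).continuousAt h1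
  have hz : ‖(0 : (ℝ ∙ v)ᗮ)‖ < r := by simpa using hr0
  have hρ0 : ρ (p + (0 : (ℝ ∙ v)ᗮ) + (0 : ℝ) • v) = 0 := by
    simpa using h.eq_zero hZ.isOpen h.mem hp
  have hrl : -r ∈ Icc (-r) r := ⟨le_rfl, by linarith⟩
  have hrr : r ∈ Icc (-r) r := ⟨by linarith, le_rfl⟩
  have hr00 : (0 : ℝ) ∈ Icc (-r) r := ⟨by linarith, hr0.le⟩
  have hneg : ρ (p + (0 : (ℝ ∙ v)ᗮ) + (-r) • v) < 0 := by
    rw [← hρ0]; exact hmono 0 hz hrl hr00 (by linarith)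
  have hposr : 0 < ρ (p + (0 : (ℝ ∙ v)ᗮ) + r • v) := by
    conv_lhs => rw [← hρ0]
    exact hmono 0 hz hr00 hrr hr0
  obtain ⟨δ', hδ', hδball⟩ := Metric.eventually_nhds_iff_ball.mp
    (((hcont 0 hz _ hrl).eventually_lt_const hneg).and
      ((hcont 0 hz _ hrr).eventually_const_lt hposr))
  have hball' : ∀ y ∈ Metric.ball (0 : (ℝ ∙ v)ᗮ) (min δ' r), ‖y‖ < r ∧
      ρ (p + y + (-r) • v) < 0 ∧ 0 < ρ (p + y + r • v) := fun y hy =>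
    ⟨by simpa using (Metric.ball_subset_ball (min_le_right _ _) hy),
      hδball y (Metric.ball_subset_ball (min_le_left _ _) hy)⟩
  have hroot : ∀ y ∈ Metric.ball (0 : (ℝ ∙ v)ᗮ) (min δ' r), ∃ s ∈ Ioo (-r) r,
      ρ (p + y + s • v) = 0 := by
    intro y hy
    obtain ⟨hyr, h1, h2⟩ := hball' y hy
    have := intermediate_value_Ioo (a := -r) (b := r) (by linarith)
      (f := fun s : ℝ => ρ (p + y + s • v))
      (fun s hs => (hderiv y hyr s hs).continuousAt.continuousWithinAt)
    exact this ⟨h1, h2⟩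
  choose! g hgI hg0 using hroot
  have hlt : ∀ y ∈ Metric.ball (0 : (ℝ ∙ v)ᗮ) (min δ' r), ∀ s ∈ Icc (-r) r,
      (ρ (p + y + s • v) < 0 ↔ s < g y) := fun y hy s hs => by
    rw [← hg0 y hy]
    exact (hmono y (hball' y hy).1).lt_iff_lt hs (Ioo_subset_Icc_self (hgI y hy))
  have hgt : ∀ y ∈ Metric.ball (0 : (ℝ ∙ v)ᗮ) (min δ' r), ∀ s ∈ Icc (-r) r,
      (0 < ρ (p + y + s • v) ↔ g y < s) := fun y hy s hs => by
    conv_lhs => rw [← hg0 y hy]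
    exact (hmono y (hball' y hy).1).lt_iff_lt (Ioo_subset_Icc_self (hgI y hy)) hs
  have hmemZ : ∀ y ∈ Metric.ball (0 : (ℝ ∙ v)ᗮ) (min δ' r), ∀ s ∈ Icc (-r) r,
      (p + y + s • v ∈ Z ↔ s < g y) := fun y hy s hs => by
    rw [h.mem_iff _ (hball _ (hmem y (hball' y hy).1 s hs)).1, hlt y hy s hs]
  refine ⟨min δ' r, lt_min hδ' hr0, r, hr0, g, ?_, hgI, fun y hy s hs =>
    ⟨hmemZ y hy s hs, fun hs' => ?_, ?_⟩, fun y hy s hs =>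
      (hball _ (hmem y (hball' y hy).1 s hs)).2.2⟩
  · intro y hy
    -- At a fixed height just below or above `g y`, the sign of `ρ` persists for nearby base points,
    -- which keeps the root on the same side of that height.
    refine ContinuousAt.continuousWithinAt (tendsto_order.mpr ⟨fun a ha => ?_, fun b hb => ?_⟩)
    · obtain ⟨a', ha1, ha2⟩ := exists_between (max_lt ha (hgI y hy).1)
      have ha' : a' ∈ Icc (-r) r :=
        ⟨((le_max_right _ _).trans_lt ha1).le, (ha2.trans (hgI y hy).2).le⟩
      filter_upwards [(hcont y (hball' y hy).1 a' ha').eventually_lt_const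
        ((hlt y hy a' ha').mpr ha2), Metric.isOpen_ball.mem_nhds hy] with z hz hzb
      exact (le_max_left _ _).trans_lt (ha1.trans ((hlt z hzb a' ha').mp hz))
    · obtain ⟨b', hb1, hb2⟩ := exists_between (lt_min hb (hgI y hy).2)
      have hb' : b' ∈ Icc (-r) r :=
        ⟨((hgI y hy).1.trans hb1).le, (hb2.trans_le (min_le_right _ _)).le⟩
      filter_upwards [(hcont y (hball' y hy).1 b' hb').eventually_const_lt
        ((hgt y hy b' hb').mpr hb1), Metric.isOpen_ball.mem_nhds hy] with z hz hzb
      exact ((hgt z hzb b' hb').mp hz).trans (hb2.trans_le (min_le_left _ _))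
  · have h0 := h.eq_zero hZ.isOpen (hball _ (hmem y (hball' y hy).1 s hs)).1 hs'
    rcases lt_trichotomy s (g y) with hl | he | hl
    · exact absurd h0 ((hlt y hy s hs).mpr hl).ne
    · exact he
    · exact absurd h0 ((hgt y hy s hs).mpr hl).ne'
  · rintro rfl
    rw [hZ.isOpen.frontier_eq]
    refine ⟨?_, fun hmz => absurd ((hmemZ y hy _ hs).mp hmz) (lt_irrefl _)⟩
    have ht : Filter.Tendsto (fun s : ℝ => p + y + s • v) (𝓝[<] (g y)) (𝓝 (p + y + g y • v)) :=
      (hline y (g y)).continuousAt.tendsto.mono_left nhdsWithin_le_nhds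
    refine mem_closure_of_tendsto ht ?_
    filter_upwards [Ioo_mem_nhdsLT (hgI y hy).1] with s' hs'
    exact (hmemZ y hy s' ⟨hs'.1.le, (hs'.2.trans (hgI y hy).2).le⟩).mpr hs'.2

end Graph

/-! ### Surface measure on a graph, and finiteness of the boundary area -/

section GraphBox

open Module
open scoped ENNReal NNReal

variable {Z : Set E3} {p v : E3} {δ r c : ℝ} {g : (ℝ ∙ v)ᗮ → ℝ}

/-- A cylinder of radius `δ` and half-height `r` about `p`, with axis `v`, in which `Z` is the
region below the graph of `g` and the normal makes an angle bounded away from `π / 2` with `v`. -/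
structure IsGraphBox (Z : Set E3) (p v : E3) (δ r c : ℝ) (g : (ℝ ∙ v)ᗮ → ℝ) : Prop where
  norm_eq : ‖v‖ = 1
  delta_pos : 0 < δ
  r_pos : 0 < r
  c_pos : 0 < c
  cont : ContinuousOn g (Metric.ball 0 δ)
  mem_Ioo : ∀ y ∈ Metric.ball (0 : (ℝ ∙ v)ᗮ) δ, g y ∈ Ioo (-r) r
  mem_iff : ∀ y ∈ Metric.ball (0 : (ℝ ∙ v)ᗮ) δ, ∀ s ∈ Icc (-r) r,
    (p + y + s • v ∈ Z ↔ s < g y)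
  frontier_iff : ∀ y ∈ Metric.ball (0 : (ℝ ∙ v)ᗮ) δ, ∀ s ∈ Icc (-r) r,
    (p + y + s • v ∈ frontier Z ↔ s = g y)
  lt_inner : ∀ y ∈ Metric.ball (0 : (ℝ ∙ v)ᗮ) δ, ∀ s ∈ Icc (-r) r,
    p + y + s • v ∈ frontier Z → c < inner ℝ (outwardNormal Z (p + y + s • v)) v

theorem IsSmoothBoundedDomain.exists_isGraphBox (hZ : IsSmoothBoundedDomain Z)
    (hp : p ∈ frontier Z) (hv : ‖v‖ = 1) (hpos : 0 < inner ℝ (outwardNormal Z p) v) :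
    ∃ δ r c g, IsGraphBox Z p v δ r c g := by
  obtain ⟨δ, hδ, r, hr, g, hg, hI, hm, hn⟩ := hZ.exists_graph hp hv hpos
  exact ⟨δ, r, _, g, hv, hδ, hr, half_pos hpos, hg, hI, fun y hy s hs => (hm y hy s hs).1,
    fun y hy s hs => (hm y hy s hs).2, hn⟩

/-- The projection of `x - p` along `v`. -/
def baseCoord (p v x : E3) : (ℝ ∙ v)ᗮ := (ℝ ∙ v)ᗮ.orthogonalProjectionOnto (x - p)

/-- The open cylinder about `p` with axis `v`. -/
def cylinder (p v : E3) (δ r : ℝ) : Set E3 :=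
  {x | baseCoord p v x ∈ Metric.ball 0 δ ∧ inner ℝ v (x - p) ∈ Ioo (-r) r}

theorem continuous_baseCoord : Continuous (baseCoord p v) :=
  (ℝ ∙ v)ᗮ.orthogonalProjectionOnto.continuous.comp (continuous_id.sub continuous_const)

theorem isOpen_cylinder : IsOpen (cylinder p v δ r) :=
  (Metric.isOpen_ball.preimage continuous_baseCoord).inter
    (isOpen_Ioo.preimage (by fun_prop : Continuous fun x : E3 => inner ℝ v (x - p)))

theorem mem_cylinder_self (hδ : 0 < δ) (hr : 0 < r) : p ∈ cylinder p v δ r := by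
  simp [cylinder, baseCoord, hδ, hr]

theorem coe_baseCoord (hv : ‖v‖ = 1) (x : E3) :
    (baseCoord p v x : E3) = x - p - inner ℝ v (x - p) • v := by
  rw [baseCoord, Submodule.coe_orthogonalProjectionOnto_apply,
    Submodule.starProjection_orthogonal_val,
    Submodule.starProjection_unit_singleton ℝ hv]

theorem eq_coords (hv : ‖v‖ = 1) (x : E3) : p + baseCoord p v x + inner ℝ v (x - p) • v = x := by
  rw [coe_baseCoord hv]
  abel

theorem inner_base (y : (ℝ ∙ v)ᗮ) : inner ℝ v (y : E3) = 0 :=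
  Submodule.mem_orthogonal_singleton_iff_inner_right.mp y.2

theorem inner_coords (hv : ‖v‖ = 1) (y : (ℝ ∙ v)ᗮ) (s : ℝ) :
    inner ℝ v (p + y + s • v - p) = s := by
  rw [add_assoc, add_sub_cancel_left, inner_add_right, inner_base, inner_smul_right,
    real_inner_self_eq_norm_sq, hv]
  ring

theorem baseCoord_coords (hv : ‖v‖ = 1) (y : (ℝ ∙ v)ᗮ) (s : ℝ) :
    baseCoord p v (p + y + s • v) = y := by
  ext1
  rw [coe_baseCoord hv, inner_coords hv]
  abel

theorem coords_mem_cylinder (hv : ‖v‖ = 1) (y : (ℝ ∙ v)ᗮ) (s : ℝ) :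
    p + y + s • v ∈ cylinder p v δ r ↔ y ∈ Metric.ball 0 δ ∧ s ∈ Ioo (-r) r := by
  rw [cylinder, mem_ofPred_eq, baseCoord_coords hv, inner_coords hv]

/-- The parametrisation of the graph of `g`. -/
def graphMap (p v : E3) (g : (ℝ ∙ v)ᗮ → ℝ) (y : (ℝ ∙ v)ᗮ) : E3 := p + y + g y • v

theorem IsGraphBox.graphMap_mem (h : IsGraphBox Z p v δ r c g) {y : (ℝ ∙ v)ᗮ}
    (hy : y ∈ Metric.ball 0 δ) : graphMap p v g y ∈ frontier Z ∩ cylinder p v δ r :=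
  ⟨(h.frontier_iff y hy _ (Ioo_subset_Icc_self (h.mem_Ioo y hy))).mpr rfl,
    (coords_mem_cylinder h.norm_eq y _).mpr ⟨hy, h.mem_Ioo y hy⟩⟩

theorem IsGraphBox.graphMap_baseCoord (h : IsGraphBox Z p v δ r c g) {x : E3}
    (hx : x ∈ frontier Z ∩ cylinder p v δ r) : graphMap p v g (baseCoord p v x) = x := by
  have h1 := (h.frontier_iff _ hx.2.1 _ (Ioo_subset_Icc_self hx.2.2)).mp
    (by rw [eq_coords h.norm_eq]; exact hx.1)
  rw [graphMap, ← h1, eq_coords h.norm_eq]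

theorem IsGraphBox.lt_inner_of_mem (h : IsGraphBox Z p v δ r c g) {x : E3}
    (hx : x ∈ frontier Z ∩ cylinder p v δ r) : c < inner ℝ (outwardNormal Z x) v := by
  have := h.lt_inner _ hx.2.1 _ (Ioo_subset_Icc_self hx.2.2)
  rw [eq_coords h.norm_eq] at this
  exact this hx.1

theorem IsGraphBox.continuousOn_graphMap (h : IsGraphBox Z p v δ r c g) :
    ContinuousOn (graphMap p v g) (Metric.ball 0 δ) :=
  (by fun_prop : Continuous fun y : (ℝ ∙ v)ᗮ => p + (y : E3)).continuousOn.add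
    (h.cont.smul continuousOn_const)

theorem IsGraphBox.preimage_graphMap (h : IsGraphBox Z p v δ r c g) {A : Set E3}
    (hA : A ⊆ frontier Z ∩ cylinder p v δ r) :
    graphMap p v g ⁻¹' A ∩ Metric.ball 0 δ = baseCoord p v '' A := by
  ext y
  constructor
  · rintro ⟨hy, hyb⟩
    exact ⟨_, hy, baseCoord_coords h.norm_eq y _⟩
  · rintro ⟨x, hx, rfl⟩
    refine ⟨?_, (hA hx).2.1⟩
    rw [mem_preimage, h.graphMap_baseCoord (hA hx)]
    exact hx

/-- The composite is the projection of `x - p` along `v` onto `nᗮ`. It moves points only along `v`,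
by an amount proportional to `⟨n, x - p⟩`. -/
theorem obliqueSection_baseCoord (hv : ‖v‖ = 1) (n : E3) (hn : inner ℝ n v ≠ 0) (x : E3) :
    obliqueSection n v (baseCoord p v x) = x - p - ((inner ℝ n v)⁻¹ * inner ℝ n (x - p)) • v := by
  rw [obliqueSection_apply, coe_baseCoord hv, inner_sub_right n (x - p), inner_smul_right, mul_sub]
  have : (inner ℝ n v)⁻¹ * (inner ℝ v (x - p) * inner ℝ n v) = inner ℝ v (x - p) := by
    field_simp
  rw [this, sub_smul]
  abel

theorem euclideanHausdorffMeasure_obliqueSection {n : E3} (hn : ‖n‖ = 1) (hv : ‖v‖ = 1)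
    (hnv : 0 < inner ℝ n v) (B : Set (ℝ ∙ v)ᗮ) :
    volume B = ENNReal.ofReal (inner ℝ n v) * μHE[2] (obliqueSection n v '' B) := by
  have : Fact (finrank ℝ E3 = 2 + 1) := ⟨by simp⟩
  have hfin : finrank ℝ (ℝ ∙ v)ᗮ = 2 :=
    Submodule.finrank_orthogonal_span_singleton fun h => by simp [h] at hv
  have h := (obliqueSection n v).euclideanHausdorffMeasure_image_eq_normDet_mul_volume B
  rw [hfin, normDet_obliqueSection hn hv hnv] at h
  rw [h, ← mul_assoc, ← ENNReal.ofReal_mul hnv.le, mul_inv_cancel₀ hnv.ne', ENNReal.ofReal_one,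
    one_mul]

/-- Near `q`, projecting the surface along `v` onto the plane `nᗮ` changes difference vectors by a
small fraction of their length, by almost-tangency, so surface area changes by at most `m ^ 2`
either way. Passing from `nᗮ` to the base `vᗮ` is linear and multiplies area by exactly `⟨n, v⟩`. -/
theorem IsGraphBox.local_comparison (h : IsGraphBox Z p v δ r c g) (hZ : IsSmoothBoundedDomain Z)
    {q : E3} (hq : q ∈ frontier Z ∩ cylinder p v δ r) {m : ℝ} (hm : 1 < m) :
    ∃ O, IsOpen O ∧ q ∈ O ∧
      (∀ x ∈ O ∩ (frontier Z ∩ cylinder p v δ r),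
        inner ℝ (outwardNormal Z x) v ≤ m * inner ℝ (outwardNormal Z q) v ∧
        inner ℝ (outwardNormal Z q) v ≤ m * inner ℝ (outwardNormal Z x) v) ∧
      ∀ A, A ⊆ O ∩ (frontier Z ∩ cylinder p v δ r) →
        volume (baseCoord p v '' A) ≤
          ENNReal.ofReal (inner ℝ (outwardNormal Z q) v) * (ENNReal.ofReal m ^ 2 * μHE[2] A) ∧
        ENNReal.ofReal (inner ℝ (outwardNormal Z q) v) * μHE[2] A ≤
          ENNReal.ofReal m ^ 2 * volume (baseCoord p v '' A) := by
  set n := outwardNormal Z q with hn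
  have hnv : 0 < inner ℝ n v := h.c_pos.trans (h.lt_inner_of_mem hq)
  have hn1 : ‖n‖ = 1 := hZ.norm_outwardNormal hq.1
  have hm0 : 0 < m := by linarith
  -- Distances are distorted by factors between `1 - a = 1 / m` and `1 + a ≤ m`, so one constant `m`
  -- serves both directions.
  set a := (m - 1) / m with ha
  have ha0 : 0 < a := div_pos (by linarith) hm0
  obtain ⟨O₁, hO₁, hqO₁, hle⟩ := hZ.exists_almost_tangent hq.1 (mul_pos ha0 hnv)
  have hcn : ContinuousWithinAt (fun x => inner ℝ (outwardNormal Z x) v) (frontier Z) q :=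
    (hZ.continuousOn_outwardNormal q hq.1).inner continuousWithinAt_const
  have hev : ∀ᶠ x in 𝓝[frontier Z] q, inner ℝ (outwardNormal Z x) v < m * inner ℝ n v ∧
      inner ℝ n v < m * inner ℝ (outwardNormal Z x) v :=
    (hcn.eventually_lt_const (show inner ℝ n v < m * inner ℝ n v by nlinarith)).and
      ((hcn.const_mul m).eventually_const_lt
        (show inner ℝ n v < m * inner ℝ n v by nlinarith))
  obtain ⟨O₂, hO₂n, hO₂⟩ := mem_nhdsWithin_iff_exists_mem_nhds_inter.mp hev
  obtain ⟨O₃, hO₃, hO₃o, hqO₃⟩ := mem_nhds_iff.mp hO₂n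
  refine ⟨O₁ ∩ O₃, hO₁.inter hO₃o, ⟨hqO₁, hqO₃⟩, fun x hx => ?_, fun A hA => ?_⟩
  · have := hO₂ ⟨hO₃ hx.1.2, hx.2.1⟩
    exact ⟨this.1.le, this.2.le⟩
  set f : E3 → E3 := fun x => obliqueSection n v (baseCoord p v x) with hf
  have hfd : ∀ x ∈ A, ∀ y ∈ A, ‖(x - y) - (f x - f y)‖ ≤ a * ‖x - y‖ := by
    intro x hx y hy
    have e : (x - y) - (f x - f y) = ((inner ℝ n v)⁻¹ * inner ℝ n (x - y)) • v := by
      simp only [hf, obliqueSection_baseCoord h.norm_eq n hnv.ne']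
      rw [show inner ℝ n (x - y) = inner ℝ n (x - p) - inner ℝ n (y - p) by
        rw [← inner_sub_right]; congr 1; abel, mul_sub, sub_smul]
      abel
    rw [e, norm_smul, h.norm_eq, mul_one, Real.norm_eq_abs, abs_mul, abs_inv, abs_of_pos hnv,
      inv_mul_le_iff₀ hnv]
    have := hle x ⟨(hA hx).1.1, (hA hx).2.1⟩ y ⟨(hA hy).1.1, (hA hy).2.1⟩
    linarith
  have ham : a * m = m - 1 := by rw [ha]; field_simp
  have hlip : LipschitzOnWith (Real.toNNReal m) f A := by
    refine LipschitzOnWith.of_dist_le_mul fun x hx y hy => ?_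
    rw [Real.coe_toNNReal _ hm0.le, dist_eq_norm, dist_eq_norm]
    have h1 := hfd x hx y hy
    have h2 : ‖f x - f y‖ ≤ ‖x - y‖ + ‖(x - y) - (f x - f y)‖ := by
      calc ‖f x - f y‖ = ‖(x - y) - ((x - y) - (f x - f y))‖ := by congr 1; abel
        _ ≤ _ := norm_sub_le _ _
    have h3 : 1 + a ≤ m := by nlinarith
    nlinarith [norm_nonneg (x - y)]
  have hanti : ∀ x ∈ A, ∀ y ∈ A, edist x y ≤ Real.toNNReal m * edist (f x) (f y) := by
    intro x hx y hy
    rw [edist_nndist, edist_nndist, ← ENNReal.coe_mul, ENNReal.coe_le_coe, ← NNReal.coe_le_coe,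
      NNReal.coe_mul, Real.coe_toNNReal _ hm0.le, coe_nndist, coe_nndist, dist_eq_norm,
      dist_eq_norm]
    have h1 := hfd x hx y hy
    have h2 : ‖x - y‖ ≤ ‖f x - f y‖ + ‖(x - y) - (f x - f y)‖ := by
      calc ‖x - y‖ = ‖(f x - f y) + ((x - y) - (f x - f y))‖ := by congr 1; abel
        _ ≤ _ := norm_add_le _ _
    have h3 : m * ‖x - y‖ ≤ m * ‖f x - f y‖ + (m - 1) * ‖x - y‖ := by
      rw [← ham]
      nlinarith
    linarith
  have hvol := euclideanHausdorffMeasure_obliqueSection hn1 h.norm_eq hnv (baseCoord p v '' A)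
  rw [image_image] at hvol
  constructor
  · rw [hvol]
    gcongr
    exact euclideanHausdorffMeasure_image_le hlip 2
  · rw [hvol, mul_left_comm]
    gcongr
    exact le_euclideanHausdorffMeasure_image hanti 2

/-- This is the surface-area formula for a graph, obtained by comparing the two measures near each
point up to every factor `κ > 1`. -/
theorem IsGraphBox.map_graphMap (h : IsGraphBox Z p v δ r c g) (hZ : IsSmoothBoundedDomain Z) :
    Measure.map (graphMap p v g) (volume.restrict (Metric.ball 0 δ)) =
      (μHE[2].restrict (frontier Z ∩ cylinder p v δ r)).withDensity
        fun x => ENNReal.ofReal (inner ℝ (outwardNormal Z x) v) := by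
  have hS : MeasurableSet (frontier Z ∩ cylinder p v δ r) :=
    isClosed_frontier.measurableSet.inter isOpen_cylinder.measurableSet
  have hae : AEMeasurable (graphMap p v g) (volume.restrict (Metric.ball 0 δ)) :=
    h.continuousOn_graphMap.aemeasurable measurableSet_ball
  have hmap : ∀ A, MeasurableSet A → Measure.map (graphMap p v g)
      (volume.restrict (Metric.ball 0 δ)) A =
        volume (graphMap p v g ⁻¹' A ∩ Metric.ball 0 δ) := fun A hA => by
    rw [Measure.map_apply_of_aemeasurable hae hA, Measure.restrict_apply' measurableSet_ball]
  refine measure_eq_of_locally hS ?_ ?_ fun κ hκ q hq => ?_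
  · rw [hmap _ hS.compl]
    convert measure_empty (μ := (volume : Measure (ℝ ∙ v)ᗮ))
    rw [eq_empty_iff_forall_notMem]
    exact fun y hy => hy.1 (h.graphMap_mem hy.2)
  · refine withDensity_absolutelyContinuous _ _ ?_
    rw [Measure.restrict_apply hS.compl, compl_inter_self, measure_empty]
  -- A cube root: two factors `m` are lost to area distortion and one to the variation of `⟨n, v⟩`
  -- near `q`.
  · set m : ℝ := (κ : ℝ) ^ (1 / 3 : ℝ) with hm
    have hm1 : 1 < m := Real.one_lt_rpow (by exact_mod_cast hκ) (by norm_num)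
    have hm3 : ENNReal.ofReal m ^ 3 = κ := by
      rw [← ENNReal.ofReal_pow (by linarith), hm, ← Real.rpow_natCast, ← Real.rpow_mul (by simp)]
      norm_num
    obtain ⟨O, hO, hqO, hnx, hA⟩ := h.local_comparison hZ hq hm1
    refine ⟨O, hO, hqO, fun A hAO hAm => ?_⟩
    obtain ⟨hA1, hA2⟩ := hA A hAO
    have hAS : A ⊆ frontier Z ∩ cylinder p v δ r := fun x hx => (hAO hx).2
    rw [hmap A hAm, h.preimage_graphMap hAS, withDensity_apply _ hAm,
      Measure.restrict_restrict hAm, inter_eq_left.mpr hAS]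
    set C := ENNReal.ofReal (inner ℝ (outwardNormal Z q) v)
    have hup : ∫⁻ x in A, ENNReal.ofReal (inner ℝ (outwardNormal Z x) v) ∂μHE[2] ≤
        ENNReal.ofReal m * C * μHE[2] A := by
      rw [← setLIntegral_const]
      refine setLIntegral_mono' hAm fun x hx => ?_
      rw [← ENNReal.ofReal_mul (by linarith)]
      exact ENNReal.ofReal_le_ofReal (hnx x (hAO hx)).1
    have hlow : C * μHE[2] A ≤ ENNReal.ofReal m *
        ∫⁻ x in A, ENNReal.ofReal (inner ℝ (outwardNormal Z x) v) ∂μHE[2] := by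
      rw [← lintegral_const_mul' _ _ ENNReal.ofReal_ne_top, ← setLIntegral_const]
      refine setLIntegral_mono' hAm fun x hx => ?_
      rw [← ENNReal.ofReal_mul (by linarith)]
      exact ENNReal.ofReal_le_ofReal (hnx x (hAO hx)).2
    rw [← hm3]
    constructor
    · calc volume (baseCoord p v '' A) ≤ C * (ENNReal.ofReal m ^ 2 * μHE[2] A) := hA1
        _ = ENNReal.ofReal m ^ 2 * (C * μHE[2] A) := by ring
        _ ≤ ENNReal.ofReal m ^ 2 * (ENNReal.ofReal m * _) := by gcongr
        _ = _ := by ring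
    · refine hup.trans ?_
      calc ENNReal.ofReal m * C * μHE[2] A = ENNReal.ofReal m * (C * μHE[2] A) := by ring
        _ ≤ ENNReal.ofReal m * (ENNReal.ofReal m ^ 2 * volume (baseCoord p v '' A)) := by gcongr
        _ = _ := by ring

/-- The density `⟨n, v⟩` exceeds `c`, so `c` times the area of the patch is at most the area of the
base disc. -/
theorem IsGraphBox.measure_lt_top (h : IsGraphBox Z p v δ r c g) (hZ : IsSmoothBoundedDomain Z) :
    μHE[2] (frontier Z ∩ cylinder p v δ r) < ⊤ := by
  have hS : MeasurableSet (frontier Z ∩ cylinder p v δ r) :=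
    isClosed_frontier.measurableSet.inter isOpen_cylinder.measurableSet
  have hae : AEMeasurable (graphMap p v g) (volume.restrict (Metric.ball 0 δ)) :=
    h.continuousOn_graphMap.aemeasurable measurableSet_ball
  have h1 : ENNReal.ofReal c * μHE[2] (frontier Z ∩ cylinder p v δ r) ≤
      volume (Metric.ball (0 : (ℝ ∙ v)ᗮ) δ) := by
    calc _ ≤ ∫⁻ x in frontier Z ∩ cylinder p v δ r,
        ENNReal.ofReal (inner ℝ (outwardNormal Z x) v) ∂μHE[2] := by
          rw [← setLIntegral_const]
          exact setLIntegral_mono' hS fun x hx =>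
            ENNReal.ofReal_le_ofReal (h.lt_inner_of_mem hx).le
      _ = Measure.map (graphMap p v g) (volume.restrict (Metric.ball 0 δ)) univ := by
          rw [h.map_graphMap hZ, withDensity_apply _ MeasurableSet.univ, Measure.restrict_univ]
      _ = _ := by
          rw [Measure.map_apply_of_aemeasurable hae MeasurableSet.univ]
          simp
  have h2 := h1.trans_lt measure_ball_lt_top
  exact (ENNReal.mul_lt_top_iff.mp h2).elim (fun h => h.2) (fun h' => h'.elim
    (fun h0 => absurd h.c_pos (not_lt.mpr (ENNReal.ofReal_eq_zero.mp h0))) fun h0 => by simp [h0])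

theorem IsSmoothBoundedDomain.measure_frontier_lt_top (hZ : IsSmoothBoundedDomain Z) :
    μHE[2] (frontier Z) < ⊤ := by
  have hc : IsCompact (frontier Z) := hZ.isBounded.isCompact_closure.of_isClosed_subset
    isClosed_frontier frontier_subset_closure
  refine hc.measure_lt_top_of_nhdsWithin fun p hp => ?_
  have hn := hZ.norm_outwardNormal hp
  obtain ⟨δ, r, c, g, h⟩ := hZ.exists_isGraphBox hp hn (by
    rw [real_inner_self_eq_norm_sq, hn]; norm_num)
  exact ⟨_, inter_mem_nhdsWithin _
    (isOpen_cylinder.mem_nhds (mem_cylinder_self h.delta_pos h.r_pos)), h.measure_lt_top hZ⟩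

end GraphBox

/-! ### The flux identity inside one graph box -/

section GraphFlux

variable {Z : Set E3} {p v : E3} {δ r c : ℝ} {g : (ℝ ∙ v)ᗮ → ℝ}

theorem measurePreserving_coords (p : E3) (hv : ‖v‖ = 1) :
    MeasurePreserving (fun q : ℝ × (ℝ ∙ v)ᗮ => p + q.2 + q.1 • v) ∧
      MeasurableEmbedding (fun q : ℝ × (ℝ ∙ v)ᗮ => p + q.2 + q.1 • v) := by
  have e1 := (LinearIsometryEquiv.toSpanUnitSingleton (𝕜 := ℝ) v hv).measurePreserving.prod
    (MeasurePreserving.id (volume : Measure (ℝ ∙ v)ᗮ))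
  have e2 := ((ℝ ∙ v).measurePreserving_measurableEquivProd p).symm
  rw [InnerProductSpace.euclideanHausdorffMeasure_eq_volume] at e2
  have heq : (fun q : ℝ × (ℝ ∙ v)ᗮ => p + q.2 + q.1 • v) =
      ((ℝ ∙ v).measurableEquivProd p).symm ∘
        (Prod.map (LinearIsometryEquiv.toSpanUnitSingleton (𝕜 := ℝ) v hv) id) := by
    ext1 q
    simp only [Function.comp_apply, Submodule.measurableEquivProd_symm_apply, Prod.map_fst,
      Prod.map_snd, id, LinearIsometryEquiv.toSpanUnitSingleton_apply, vadd_eq_add]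
    abel
  rw [heq]
  refine ⟨e2.comp e1, (MeasurableEquiv.measurableEmbedding _).comp ?_⟩
  exact (LinearIsometryEquiv.toSpanUnitSingleton (𝕜 := ℝ) v hv).toHomeomorph.measurableEmbedding.prodMap
    MeasurableEmbedding.id

/-- `fderiv` is measurable for any function, so boundedness on the finite-measure set `Z` suffices;
continuity of the derivative is not needed. -/
theorem integrableOn_fderiv_apply (hZ : IsSmoothBoundedDomain Z) {u : E3 → ℝ}
    (hb : ∃ C, ∀ x ∈ Z, ‖fderiv ℝ u x‖ ≤ C) (w : E3) :
    IntegrableOn (fun x => fderiv ℝ u x w) Z := by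
  obtain ⟨C, hC⟩ := hb
  refine Measure.integrableOn_of_bounded (M := C * ‖w‖) hZ.isBounded.measure_lt_top.ne
    (measurable_fderiv_apply_const ℝ u w).aestronglyMeasurable ?_
  filter_upwards [ae_restrict_mem hZ.isOpen.measurableSet] with x hx
  exact (ContinuousLinearMap.le_opNorm _ _).trans
    (mul_le_mul_of_nonneg_right (hC x hx) (norm_nonneg _))

/-- The fundamental theorem of calculus on the part of the line below the graph. At the top endpoint
only continuity of `u` is used, since `u` need not be differentiable on the boundary. -/
theorem IsGraphBox.integral_line (h : IsGraphBox Z p v δ r c g)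
    {u : E3 → ℝ} (hc : ContinuousOn u (closure Z)) (hd : ∀ x ∈ Z, DifferentiableAt ℝ u x)
    (hb : ∃ C, ∀ x ∈ Z, ‖fderiv ℝ u x‖ ≤ C) (hs : tsupport u ⊆ cylinder p v δ r)
    (y : (ℝ ∙ v)ᗮ) :
    ∫ s : ℝ, Z.indicator (fun x => fderiv ℝ u x v) (p + y + s • v) =
      (Metric.ball 0 δ).indicator (fun y => u (graphMap p v g y)) y := by
  have hzero : ∀ x ∉ cylinder p v δ r, u x = 0 ∧ fderiv ℝ u x v = 0 := fun x hx => by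
    have hx' : x ∉ tsupport u := fun h' => hx (hs h')
    rw [fderiv_of_notMem_tsupport (𝕜 := ℝ) hx', image_eq_zero_of_notMem_tsupport hx']
    simp
  by_cases hy : y ∈ Metric.ball 0 δ
  swap
  · rw [indicator_of_notMem hy]
    have : ∀ s : ℝ, Z.indicator (fun x => fderiv ℝ u x v) (p + y + s • v) = 0 := fun s => by
      refine indicator_apply_eq_zero.mpr fun _ => (hzero _ fun hcyl => hy ?_).2
      exact ((coords_mem_cylinder h.norm_eq y s).mp hcyl).1
    simp [this]
  rw [indicator_of_mem hy]
  have hg := h.mem_Ioo y hy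
  have hle : -r ≤ g y := hg.1.le
  have hind : ∀ s : ℝ, Z.indicator (fun x => fderiv ℝ u x v) (p + y + s • v) =
      (Ioo (-r) (g y)).indicator (fun s => fderiv ℝ u (p + y + s • v) v) s := by
    intro s
    by_cases hsI : s ∈ Ioo (-r) r
    · have := h.mem_iff y hy s (Ioo_subset_Icc_self hsI)
      by_cases hsg : s < g y
      · rw [indicator_of_mem (this.mpr hsg), indicator_of_mem (show s ∈ Ioo _ _ from ⟨hsI.1, hsg⟩)]
      · rw [indicator_of_notMem (fun h' => hsg (this.mp h')),
          indicator_of_notMem fun h' : s ∈ Ioo _ _ => hsg h'.2]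
    · rw [indicator_of_notMem fun h' : s ∈ Ioo _ _ => hsI ⟨h'.1, h'.2.trans hg.2⟩]
      refine indicator_apply_eq_zero.mpr fun _ => (hzero _ fun hcyl => hsI ?_).2
      exact ((coords_mem_cylinder h.norm_eq y s).mp hcyl).2
  simp_rw [hind]
  rw [integral_indicator measurableSet_Ioo, ← integral_Ioc_eq_integral_Ioo,
    ← intervalIntegral.integral_of_le hle]
  have hline : ∀ s : ℝ, HasDerivAt (fun s : ℝ => p + y + s • v) v s := fun s => by
    simpa using ((hasDerivAt_id s).smul_const v).const_add (p + (y : E3))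
  have hmemZ : ∀ s ∈ Ico (-r) (g y), p + y + s • v ∈ Z := fun s hs =>
    (h.mem_iff y hy s ⟨hs.1, (hs.2.trans hg.2).le⟩).mpr hs.2
  have hmemc : MapsTo (fun s : ℝ => p + y + s • v) (Icc (-r) (g y)) (closure Z) := by
    intro s hs
    rcases hs.2.lt_or_eq with hlt | rfl
    · exact subset_closure (hmemZ s ⟨hs.1, hlt⟩)
    · exact frontier_subset_closure (h.graphMap_mem hy).1
  rw [intervalIntegral.integral_eq_sub_of_hasDerivAt_of_le hle
    (f := fun s => u (p + y + s • v))]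
  -- The bottom endpoint is outside the open cylinder, hence outside the support of `u`, and
  -- contributes nothing.
  · rw [(hzero (p + y + (-r) • v) fun hcyl => ?_).1, sub_zero]
    · rfl
    · exact lt_irrefl _ ((coords_mem_cylinder h.norm_eq y _).mp hcyl).2.1
  · exact hc.comp (fun s _ => (hline s).continuousAt.continuousWithinAt) hmemc
  · intro s hs
    exact HasFDerivAt.comp_hasDerivAt s
      (hd _ (hmemZ s (Ioo_subset_Ico_self hs))).hasFDerivAt (hline s)
  · rw [intervalIntegrable_iff_integrableOn_Ioo_of_le hle]
    obtain ⟨C, hC⟩ := hb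
    refine Measure.integrableOn_of_bounded (M := C * ‖v‖) (by simp) ?_ ?_
    · have hm : Measurable fun s : ℝ => p + y + s • v := by fun_prop
      exact ((measurable_fderiv_apply_const ℝ u v).comp hm).aestronglyMeasurable
    · filter_upwards [ae_restrict_mem measurableSet_Ioo] with s hs
      exact (ContinuousLinearMap.le_opNorm _ _).trans (mul_le_mul_of_nonneg_right
        (hC _ (hmemZ s (Ioo_subset_Ico_self hs))) (norm_nonneg _))

theorem IsGraphBox.integral_graph (h : IsGraphBox Z p v δ r c g) (hZ : IsSmoothBoundedDomain Z)
    {u : E3 → ℝ} (hc : ContinuousOn u (closure Z)) (hs : tsupport u ⊆ cylinder p v δ r) :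
    ∫ y in Metric.ball 0 δ, u (graphMap p v g y) =
      ∫ x in frontier Z, u x * inner ℝ (outwardNormal Z x) v ∂μHE[2] := by
  have hS : MeasurableSet (frontier Z ∩ cylinder p v δ r) :=
    isClosed_frontier.measurableSet.inter isOpen_cylinder.measurableSet
  have hae : AEMeasurable (graphMap p v g) (volume.restrict (Metric.ball 0 δ)) :=
    h.continuousOn_graphMap.aemeasurable measurableSet_ball
  have hu : AEStronglyMeasurable u (μHE[2].restrict (frontier Z ∩ cylinder p v δ r)) :=
    (hc.mono (inter_subset_left.trans frontier_subset_closure)).aestronglyMeasurable hS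
  have hn : AEMeasurable (fun x => ENNReal.ofReal (inner ℝ (outwardNormal Z x) v))
      (μHE[2].restrict (frontier Z ∩ cylinder p v δ r)) :=
    (((hZ.continuousOn_outwardNormal.mono inter_subset_left).inner
      continuousOn_const).aemeasurable hS).ennreal_ofReal
  have hmap := h.map_graphMap hZ
  rw [← integral_map (f := u) hae (by
    rw [hmap]; exact hu.mono_ac (withDensity_absolutelyContinuous _ _)), hmap,
    integral_withDensity_eq_integral_toReal_smul₀ hn (by simp)]
  have h1 : ∫ x in frontier Z ∩ cylinder p v δ r,
      (ENNReal.ofReal (inner ℝ (outwardNormal Z x) v)).toReal • u x ∂μHE[2] =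
      ∫ x in frontier Z ∩ cylinder p v δ r, u x * inner ℝ (outwardNormal Z x) v ∂μHE[2] := by
    refine setIntegral_congr_fun hS fun x hx => ?_
    rw [ENNReal.toReal_ofReal (h.c_pos.trans (h.lt_inner_of_mem hx)).le, smul_eq_mul, mul_comm]
  rw [h1]
  refine (setIntegral_eq_of_subset_of_forall_sdiff_eq_zero isClosed_frontier.measurableSet
    inter_subset_left fun x hx => ?_).symm
  rw [image_eq_zero_of_notMem_tsupport fun hx' => hx.2 ⟨hx.1, hs hx'⟩, zero_mul]

theorem IsGraphBox.integral_fderiv (h : IsGraphBox Z p v δ r c g) (hZ : IsSmoothBoundedDomain Z)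
    {u : E3 → ℝ} (hc : ContinuousOn u (closure Z)) (hd : ∀ x ∈ Z, DifferentiableAt ℝ u x)
    (hb : ∃ C, ∀ x ∈ Z, ‖fderiv ℝ u x‖ ≤ C) (hs : tsupport u ⊆ cylinder p v δ r) :
    ∫ x in Z, fderiv ℝ u x v =
      ∫ x in frontier Z, u x * inner ℝ (outwardNormal Z x) v ∂μHE[2] := by
  obtain ⟨hmp, hme⟩ := measurePreserving_coords p h.norm_eq
  have hint : Integrable (Z.indicator fun x => fderiv ℝ u x v) :=
    (integrable_indicator_iff hZ.isOpen.measurableSet).mpr (integrableOn_fderiv_apply hZ hb v)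
  rw [← integral_indicator hZ.isOpen.measurableSet, ← hmp.integral_comp hme]
  have hint' := (hmp.integrable_comp_emb hme).mpr hint
  -- The height along `v` is the first factor of the product, so the symmetric form of Fubini puts
  -- the line integral inside.
  rw [Measure.volume_eq_prod, integral_prod_symm _ (by exact hint')]
  simp only [h.integral_line hc hd hb hs]
  rw [integral_indicator measurableSet_ball, h.integral_graph hZ hc hs]

end GraphFlux

/-! ### The divergence theorem on the whole domain -/

section Gauss

open scoped Manifold

variable {Z : Set E3}

/-- Functions that are continuous on the closure of `Z` and differentiable in `Z` with bounded
derivative. -/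
structure HasBoundedGradient (Z : Set E3) (u : E3 → ℝ) : Prop where
  cont : ContinuousOn u (closure Z)
  diff : ∀ x ∈ Z, DifferentiableAt ℝ u x
  bound : ∃ C, ∀ x ∈ Z, ‖fderiv ℝ u x‖ ≤ C

/-- The flux identity `∫_Z ∂_v u = ∫_{∂Z} u ⟨n, v⟩`. -/
def FluxIdentity (Z : Set E3) (v : E3) (u : E3 → ℝ) : Prop :=
  ∫ x in Z, fderiv ℝ u x v = ∫ x in frontier Z, u x * inner ℝ (outwardNormal Z x) v ∂μHE[2]

theorem IsSmoothBoundedDomain.isCompact_closure (hZ : IsSmoothBoundedDomain Z) :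
    IsCompact (closure Z) := hZ.isBounded.isCompact_closure

theorem IsSmoothBoundedDomain.isCompact_frontier (hZ : IsSmoothBoundedDomain Z) :
    IsCompact (frontier Z) :=
  hZ.isCompact_closure.of_isClosed_subset isClosed_frontier frontier_subset_closure

theorem IsSmoothBoundedDomain.integrableOn_frontier (hZ : IsSmoothBoundedDomain Z) {f : E3 → ℝ}
    (hf : ContinuousOn f (frontier Z)) : IntegrableOn f (frontier Z) μHE[2] :=
  hf.integrableOn_of_subset_isCompact hZ.isCompact_frontier isClosed_frontier.measurableSet
    Subset.rfl hZ.measure_frontier_lt_top.ne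

theorem HasBoundedGradient.integrableOn_flux {u : E3 → ℝ} (hu : HasBoundedGradient Z u)
    (hZ : IsSmoothBoundedDomain Z) (v : E3) :
    IntegrableOn (fun x => u x * inner ℝ (outwardNormal Z x) v) (frontier Z) μHE[2] :=
  hZ.integrableOn_frontier ((hu.cont.mono frontier_subset_closure).mul
    (hZ.continuousOn_outwardNormal.inner continuousOn_const))

theorem FluxIdentity.linear_comb (hZ : IsSmoothBoundedDomain Z) {u : E3 → ℝ}
    (hu : HasBoundedGradient Z u) {v w : E3} (hv : FluxIdentity Z v u) (hw : FluxIdentity Z w u)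
    (a b : ℝ) : FluxIdentity Z (a • v + b • w) u := by
  unfold FluxIdentity at *
  simp only [map_add, map_smul, inner_add_right, inner_smul_right, smul_eq_mul, mul_add]
  rw [integral_add ((integrableOn_fderiv_apply hZ hu.bound v).const_mul a)
    ((integrableOn_fderiv_apply hZ hu.bound w).const_mul b), integral_const_mul,
    integral_const_mul, hv, hw]
  simp only [mul_left_comm (u _)]
  rw [integral_add ((hu.integrableOn_flux hZ v).const_mul a)
    ((hu.integrableOn_flux hZ w).const_mul b), integral_const_mul, integral_const_mul]

/-- Both sides vanish: such a `u` is compactly supported and differentiable everywhere, so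
integration by parts against the constant 1 gives zero, and `u` is zero on the boundary. -/
theorem fluxIdentity_of_tsupport_subset (hZ : IsSmoothBoundedDomain Z) {u : E3 → ℝ}
    (hu : HasBoundedGradient Z u) (hs : tsupport u ⊆ Z) (v : E3) : FluxIdentity Z v u := by
  have hd : Differentiable ℝ u := fun x => by
    by_cases hx : x ∈ tsupport u
    · exact hu.diff x (hs hx)
    · exact (differentiableAt_const (0 : ℝ)).congr_of_eventuallyEq
        (notMem_tsupport_iff_eventuallyEq.mp hx)
  have hzero : ∀ x ∉ Z, fderiv ℝ u x v = 0 := fun x hx => by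
    rw [fderiv_of_notMem_tsupport (𝕜 := ℝ) fun h => hx (hs h)]
    rfl
  have hint : Integrable (fun x => fderiv ℝ u x v) :=
    (integrableOn_iff_integrable_of_support_subset fun x hx => by
      by_contra hxZ
      exact hx (hzero x hxZ)).mp (integrableOn_fderiv_apply hZ hu.bound v)
  have hcs : HasCompactSupport u :=
    hZ.isCompact_closure.of_isClosed_subset (isClosed_tsupport u) (hs.trans subset_closure)
  have h := integral_mul_fderiv_eq_neg_fderiv_mul_of_integrable (μ := (volume : Measure E3))
    (𝕜 := ℝ) (f := fun _ : E3 => (1 : ℝ)) (g := u) (v := v) (by simp) (by simpa using hint)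
    (by simpa using hd.continuous.integrable_of_hasCompactSupport hcs)
    (fun _ _ => differentiableAt_const _) (fun x _ => hd x)
  simp only [one_mul, fderiv_fun_const, Pi.zero_apply, zero_apply, zero_mul,
    integral_zero, neg_zero] at h
  unfold FluxIdentity
  rw [setIntegral_eq_integral_of_forall_compl_eq_zero hzero, h]
  refine (setIntegral_eq_zero_of_forall_eq_zero fun x hx => ?_).symm
  rw [hZ.isOpen.frontier_eq] at hx
  rw [image_eq_zero_of_notMem_tsupport fun h' => hx.2 (hs h'), zero_mul]

/-- A graph box needs a direction pointing outwards, while `v` is arbitrary. At a boundary point `v`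
is written as `w - t • n` with both `w` and `n` pointing outwards, and linearity in the direction
finishes. -/
theorem exists_fluxIdentity_nhds (hZ : IsSmoothBoundedDomain Z) {p : E3} (hp : p ∈ closure Z)
    (v : E3) : ∃ O, IsOpen O ∧ p ∈ O ∧
      ∀ u, HasBoundedGradient Z u → tsupport u ⊆ O → FluxIdentity Z v u := by
  by_cases hpZ : p ∈ Z
  · exact ⟨Z, hZ.isOpen, hpZ, fun u hu hs => fluxIdentity_of_tsupport_subset hZ hu hs v⟩
  have hpf : p ∈ frontier Z := by rw [hZ.isOpen.frontier_eq]; exact ⟨hp, hpZ⟩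
  have hunit : ∀ w : E3, ‖w‖ = 1 → 0 < inner ℝ (outwardNormal Z p) w → ∃ O, IsOpen O ∧ p ∈ O ∧
      ∀ u, HasBoundedGradient Z u → tsupport u ⊆ O → FluxIdentity Z w u := by
    intro w hw hpos
    obtain ⟨δ, r, c, g, h⟩ := hZ.exists_isGraphBox hpf hw hpos
    exact ⟨_, isOpen_cylinder, mem_cylinder_self h.delta_pos h.r_pos, fun u hu hs =>
      h.integral_fderiv hZ hu.cont hu.diff hu.bound hs⟩
  set n := outwardNormal Z p
  have hn : ‖n‖ = 1 := hZ.norm_outwardNormal hpf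
  have hnn : inner ℝ n n = (1 : ℝ) := by rw [real_inner_self_eq_norm_sq, hn]; norm_num
  -- This choice forces `⟨n, w⟩ ≥ 1`.
  set t := 1 + |inner ℝ n v| with ht
  set w := v + t • n with hw
  have hnw : 0 < inner ℝ n w := by
    rw [hw, inner_add_right, inner_smul_right, hnn, ht]
    linarith [neg_abs_le (inner ℝ n v)]
  have hw0 : w ≠ 0 := fun h0 => by simp [h0] at hnw
  obtain ⟨O₁, hO₁, hp₁, h₁⟩ := hunit n hn (by rw [hnn]; norm_num)
  obtain ⟨O₂, hO₂, hp₂, h₂⟩ := hunit (‖w‖⁻¹ • w) (norm_inv_smul_self hw0) (by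
    rw [inner_smul_right]
    exact mul_pos (inv_pos.mpr (norm_pos_iff.mpr hw0)) hnw)
  refine ⟨O₁ ∩ O₂, hO₁.inter hO₂, ⟨hp₁, hp₂⟩, fun u hu hs => ?_⟩
  have := FluxIdentity.linear_comb hZ hu (h₂ u hu (hs.trans inter_subset_right))
    (h₁ u hu (hs.trans inter_subset_left)) ‖w‖ (-t)
  rwa [smul_inv_smul₀ (norm_ne_zero_iff.mpr hw0), hw, neg_smul, add_neg_cancel_right] at this

theorem HasBoundedGradient.mul (hZ : IsSmoothBoundedDomain Z) {u f : E3 → ℝ}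
    (hu : HasBoundedGradient Z u) (hf : ContDiff ℝ 1 f) :
    HasBoundedGradient Z fun x => f x * u x := by
  have hfd : Differentiable ℝ f := hf.differentiable (by simp)
  obtain ⟨C₁, h₁⟩ := hZ.isCompact_closure.exists_bound_of_continuousOn hu.cont
  obtain ⟨C₂, h₂⟩ := hZ.isCompact_closure.exists_bound_of_continuousOn hf.continuous.continuousOn
  obtain ⟨C₃, h₃⟩ := hZ.isCompact_closure.exists_bound_of_continuousOn
    (hf.continuous_fderiv (by simp)).continuousOn
  obtain ⟨C₄, h₄⟩ := hu.bound
  refine ⟨hf.continuous.continuousOn.mul hu.cont, fun x hx => (hfd x).mul (hu.diff x hx),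
    C₂ * C₄ + C₁ * C₃, fun x hx => ?_⟩
  rw [fderiv_fun_mul (hfd x) (hu.diff x hx)]
  refine (norm_add_le _ _).trans ?_
  rw [norm_smul, norm_smul]
  have hxc := subset_closure hx
  exact add_le_add
    (mul_le_mul (h₂ x hxc) (h₄ x hx) (norm_nonneg _) ((norm_nonneg _).trans (h₂ x hxc)))
    (mul_le_mul (h₁ x hxc) (h₃ x hxc) (norm_nonneg _) ((norm_nonneg _).trans (h₁ x hxc)))

/-- A smooth partition of unity subordinate to finitely many of the local neighbourhoods splits `u`
on the compact closure of `Z` into pieces that each satisfy the identity. -/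
theorem HasBoundedGradient.fluxIdentity (hZ : IsSmoothBoundedDomain Z) {u : E3 → ℝ}
    (hu : HasBoundedGradient Z u) (v : E3) : FluxIdentity Z v u := by
  choose! O hO hpO hflux using fun (p : E3) (hp : p ∈ closure Z) =>
    exists_fluxIdentity_nhds hZ hp v
  obtain ⟨t, htZ, hcov⟩ := hZ.isCompact_closure.elim_nhds_subcover O fun p hp =>
    (hO p hp).mem_nhds (hpO p hp)
  obtain ⟨f, hf⟩ := SmoothPartitionOfUnity.exists_isSubordinate 𝓘(ℝ, E3)
    (isClosed_closure (s := Z)) (fun p : t => O p) (fun p => hO p (htZ p p.2)) (by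
      intro x hx
      obtain ⟨p, hp, hxp⟩ := mem_iUnion₂.mp (hcov hx)
      exact mem_iUnion.mpr ⟨⟨p, hp⟩, hxp⟩)
  have hsm : ∀ p : t, ContDiff ℝ 1 (f p) := fun p =>
    (f p).contMDiff.contDiff.of_le (by simp)
  have hreg : ∀ p : t, HasBoundedGradient Z fun x => f p x * u x := fun p => hu.mul hZ (hsm p)
  have hsum : ∀ x ∈ closure Z, u x = ∑ p : t, f p x * u x := fun x hx => by
    have := f.sum_eq_one hx
    rw [finsum_eq_sum_of_fintype] at this
    rw [← Finset.sum_mul, this, one_mul]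
  have hfl : ∀ p : t, FluxIdentity Z v fun x => f p x * u x := fun p =>
    hflux p (htZ p p.2) _ (hreg p) ((tsupport_mul_subset_left).trans (hf p))
  have hfd : ∀ x ∈ Z, fderiv ℝ u x v = ∑ p : t, fderiv ℝ (fun x => f p x * u x) x v := by
    intro x hx
    have he : u =ᶠ[𝓝 x] fun x => ∑ p : t, f p x * u x := by
      filter_upwards [hZ.isOpen.mem_nhds hx] with y hy using hsum y (subset_closure hy)
    rw [he.fderiv_eq, fderiv_fun_sum fun p _ => (hreg p).diff x hx]
    simp
  unfold FluxIdentity at *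
  rw [setIntegral_congr_fun hZ.isOpen.measurableSet hfd,
    integral_finsetSum _ fun p _ => integrableOn_fderiv_apply hZ (hreg p).bound v,
    Finset.sum_congr rfl fun p _ => hfl p,
    ← integral_finsetSum _ fun p _ => (hreg p).integrableOn_flux hZ v]
  refine setIntegral_congr_fun isClosed_frontier.measurableSet fun x hx => ?_
  rw [← Finset.sum_mul, ← hsum x (frontier_subset_closure hx)]

end Gauss

/-! ### Regularity in time, up to the boundary of the domain -/

section TimeDependence

variable {Z : Set E3} {I : Set ℝ} {F : Type*} [NormedAddCommGroup F] [NormedSpace ℝ F]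

theorem hasDerivAt_time_of_hasFDerivWithinAt {K : Set E3} {f : ℝ × E3 → F}
    {f' : ℝ × E3 →L[ℝ] F} {q : ℝ × E3} (hI : IsOpen I) (hq : q ∈ I ×ˢ K)
    (h : HasFDerivWithinAt f f' (I ×ˢ K) q) :
    HasDerivAt (fun s => f (s, q.2)) (f' (1, 0)) q.1 := by
  have hline : HasDerivWithinAt (fun s : ℝ => (s, q.2)) ((1 : ℝ), (0 : E3)) I q.1 :=
    (hasDerivWithinAt_id q.1 I).prodMk (hasDerivWithinAt_const q.1 I q.2)
  have := h.comp_hasDerivWithinAt (f := fun s : ℝ => (s, q.2)) q.1 hline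
    (fun s hs => ⟨hs, hq.2⟩)
  exact this.hasDerivAt (hI.mem_nhds hq.1)

theorem hasDerivAt_time {K : Set E3} {f : ℝ × E3 → F} {n : WithTop ℕ∞} (hn : 1 ≤ n)
    (hI : IsOpen I) (hf : ContDiffOn ℝ n f (I ×ˢ K)) {t : ℝ} {x : E3} (ht : t ∈ I) (hx : x ∈ K) :
    HasDerivAt (fun s => f (s, x)) (deriv (fun s => f (s, x)) t) t := by
  have hq : (t, x) ∈ I ×ˢ K := ⟨ht, hx⟩
  have := hasDerivAt_time_of_hasFDerivWithinAt hI hq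
    ((hf.differentiableOn (by positivity) _ hq).hasFDerivWithinAt)
  exact this.differentiableAt.hasDerivAt

/-- Derivatives within `I ×ˢ K` need not be unique for general `K`. Because `I` is open, however,
the value on the time direction `(1, 0)` is forced to be the ordinary time derivative and inherits
the regularity of any local choice. -/
theorem contDiffOn_deriv_time {K : Set E3} {f : ℝ × E3 → F} {n : ℕ}
    (hI : IsOpen I) (hf : ContDiffOn ℝ (n + 1) f (I ×ˢ K)) :
    ContDiffOn ℝ n (fun q : ℝ × E3 => deriv (fun s => f (s, q.2)) q.1) (I ×ˢ K) := by
  intro q hq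
  obtain ⟨u, hu, huI, -, f', hf', hc⟩ :=
    (contDiffWithinAt_succ_iff_hasFDerivWithinAt' (by simp)).mp (hf q hq)
  rw [insert_eq_of_mem hq] at hu huI
  have heq : ∀ z ∈ u, deriv (fun s => f (s, z.2)) z.1 = f' z (1, 0) := fun z hz =>
    (hasDerivAt_time_of_hasFDerivWithinAt hI (huI hz) (hf' z hz)).deriv
  exact (hc.clm_apply contDiffWithinAt_const).congr_of_eventuallyEq
    (Filter.eventually_of_mem hu heq) (heq q (mem_of_mem_nhdsWithin hq hu))

/-- Near each point of the closure there is a derivative within the set that is continuous at that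
point, hence locally bounded. It agrees with `fderiv` inside `Z`, and compactness makes the bound
uniform. -/
theorem hasBoundedGradient_of_contDiffOn (hZ : IsSmoothBoundedDomain Z) {u : E3 → ℝ}
    (hu : ContDiffOn ℝ 1 u (closure Z)) : HasBoundedGradient Z u := by
  refine ⟨hu.continuousOn, fun x hx => (hu.differentiableOn (by simp)).differentiableAt
    (Filter.mem_of_superset (hZ.isOpen.mem_nhds hx) subset_closure), ?_⟩
  suffices h : ∃ C, ∀ x ∈ closure Z, x ∈ Z → ‖fderiv ℝ u x‖ ≤ C by
    obtain ⟨C, hC⟩ := h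
    exact ⟨C, fun x hx => hC x (subset_closure hx) hx⟩
  refine hZ.isCompact_closure.induction_on (p := fun s => ∃ C, ∀ x ∈ s, x ∈ Z →
    ‖fderiv ℝ u x‖ ≤ C) ⟨0, by simp⟩ ?_ ?_ ?_
  · rintro s t hst ⟨C, hC⟩
    exact ⟨C, fun x hx => hC x (hst hx)⟩
  · rintro s t ⟨C, hC⟩ ⟨D, hD⟩
    exact ⟨max C D, fun x hx hxZ => hx.elim (fun h => (hC x h hxZ).trans (le_max_left _ _))
      fun h => (hD x h hxZ).trans (le_max_right _ _)⟩
  · intro x hx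
    obtain ⟨u', hu', huI, -, f', hf', hc⟩ := (contDiffWithinAt_succ_iff_hasFDerivWithinAt'
      (n := 0) (by simp)).mp (by simpa using hu x hx)
    rw [insert_eq_of_mem hx] at hu' huI
    have hev := hc.continuousWithinAt.norm.eventually_lt_const (lt_add_one ‖f' x‖)
    refine ⟨u' ∩ {y | ‖f' y‖ < ‖f' x‖ + 1}, Filter.inter_mem hu' hev, ‖f' x‖ + 1, ?_⟩
    rintro y ⟨hy, hy'⟩ hyZ
    have hd : HasFDerivAt u (f' y) y := (hf' y hy).hasFDerivAt
      (Filter.mem_of_superset (hZ.isOpen.mem_nhds hyZ) subset_closure)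
    rw [hd.fderiv]
    exact le_of_lt hy'

theorem contDiffOn_slice {K : Set E3} {f : ℝ × E3 → F} {n : WithTop ℕ∞}
    (hf : ContDiffOn ℝ n f (I ×ˢ K)) {t : ℝ} (ht : t ∈ I) :
    ContDiffOn ℝ n (fun x => f (t, x)) K :=
  hf.comp (contDiff_prodMk_right t).contDiffOn fun _ hx => ⟨ht, hx⟩

/-- Symmetry of the second derivative, applied to the time direction `(1, 0)` and the space
direction `(0, v)`. -/
theorem hasDerivAt_fderiv_time {f : ℝ × E3 → ℝ} {t : ℝ} {x : E3} (hf : ContDiffAt ℝ 2 f (t, x))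
    (v : E3) : HasDerivAt (fun s => fderiv ℝ (fun y => f (s, y)) x v)
      (fderiv ℝ (fun y => deriv (fun s => f (s, y)) t) x v) t := by
  have hev : ∀ᶠ q in 𝓝 (t, x), DifferentiableAt ℝ f q := by
    filter_upwards [hf.eventually (by simp)] with q hq using hq.differentiableAt (by simp)
  have hs : ∀ (s : ℝ) (y : E3), HasDerivAt (fun s : ℝ => (s, y)) ((1 : ℝ), (0 : E3)) s :=
    fun s y => (hasDerivAt_id s).prodMk (hasDerivAt_const s y)
  have hy : ∀ (s : ℝ) (y : E3), HasFDerivAt (fun y : E3 => (s, y))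
      (ContinuousLinearMap.inr ℝ ℝ E3) y := fun s y => hasFDerivAt_prodMk_right s y
  have hD : HasFDerivAt (fderiv ℝ f) (fderiv ℝ (fderiv ℝ f) (t, x)) (t, x) :=
    ((hf.fderiv_right (m := 1) (by norm_num)).differentiableAt (by simp)).hasFDerivAt
  have h1 : (fun s => fderiv ℝ (fun y => f (s, y)) x v) =ᶠ[𝓝 t]
      fun s => fderiv ℝ f (s, x) (0, v) := by
    filter_upwards [(hs t x).continuousAt.eventually hev] with s hd
    have := (hd.hasFDerivAt.comp x (hy s x)).fderiv
    rw [show (fun y => f (s, y)) = f ∘ fun y => (s, y) from rfl, this]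
    simp
  have h2 : (fun y => deriv (fun s => f (s, y)) t) =ᶠ[𝓝 x] fun y => fderiv ℝ f (t, y) (1, 0) := by
    filter_upwards [(hy t x).continuousAt.eventually hev] with y hd
    exact (hd.hasFDerivAt.comp_hasDerivAt t (hs t y)).deriv
  have h3 : HasDerivAt (fun s => fderiv ℝ f (s, x) (0, v))
      (fderiv ℝ (fderiv ℝ f) (t, x) (1, 0) (0, v)) t := by
    have := HasFDerivAt.comp_hasDerivAt t hD (hs t x)
    simpa using this.clm_apply (hasDerivAt_const t ((0 : ℝ), v))
  have h4 : HasFDerivAt (fun y => fderiv ℝ f (t, y) (1, 0)) _ x :=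
    (hD.comp x (hy t x)).clm_apply (hasFDerivAt_const ((1 : ℝ), (0 : E3)) x)
  have hsymm := (hf.isSymmSndFDerivAt (by simp)).eq (1, 0) (0, v)
  rw [h2.fderiv_eq, h4.fderiv]
  refine (h3.congr_of_eventuallyEq h1).congr_deriv ?_
  rw [hsymm]
  simp

theorem exists_bound_near {K : Set E3} (hI : IsOpen I) (hK : IsCompact K) {f : ℝ → E3 → ℝ}
    (hf : ContinuousOn (fun q : ℝ × E3 => f q.1 q.2) (I ×ˢ K)) {t : ℝ} (ht : t ∈ I) :
    ∃ ε > 0, Metric.ball t ε ⊆ I ∧ ∃ C, ∀ s ∈ Metric.ball t ε, ∀ x ∈ K, ‖f s x‖ ≤ C := by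
  obtain ⟨ε, hε, hball⟩ := Metric.nhds_basis_closedBall.mem_iff.mp (hI.mem_nhds ht)
  obtain ⟨C, hC⟩ := ((isCompact_closedBall t ε).prod hK).exists_bound_of_continuousOn
    (hf.mono (prod_mono hball Subset.rfl))
  exact ⟨ε, hε, Metric.ball_subset_closedBall.trans hball, C, fun s hs x hx =>
    hC (s, x) ⟨Metric.ball_subset_closedBall hs, hx⟩⟩

theorem continuousOn_slice {K : Set E3} {f : ℝ → E3 → ℝ}
    (hf : ContinuousOn (fun q : ℝ × E3 => f q.1 q.2) (I ×ˢ K)) {t : ℝ} (ht : t ∈ I) :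
    ContinuousOn (f t) K :=
  hf.comp (continuous_const.prodMk continuous_id).continuousOn fun _ hx => ⟨ht, hx⟩

theorem IsSmoothBoundedDomain.integrableOn_of_continuousOn (hZ : IsSmoothBoundedDomain Z)
    {f : E3 → ℝ} (hf : ContinuousOn f (closure Z)) : IntegrableOn f Z :=
  (hf.integrableOn_compact hZ.isCompact_closure).mono_set subset_closure

theorem IsSmoothBoundedDomain.hasDerivAt_integral (hZ : IsSmoothBoundedDomain Z) (hI : IsOpen I)
    {f f' : ℝ → E3 → ℝ} (hf : ∀ t ∈ I, ContinuousOn (f t) (closure Z))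
    (hf' : ContinuousOn (fun q : ℝ × E3 => f' q.1 q.2) (I ×ˢ closure Z))
    (hd : ∀ t ∈ I, ∀ x ∈ closure Z, HasDerivAt (fun s => f s x) (f' t x) t) {t : ℝ} (ht : t ∈ I) :
    HasDerivAt (fun s => ∫ x in Z, f s x) (∫ x in Z, f' t x) t := by
  obtain ⟨ε, hε, hball, C, hC⟩ := exists_bound_near hI hZ.isCompact_closure hf' ht
  have hfin : IsFiniteMeasure (volume.restrict Z) := ⟨by
    rw [Measure.restrict_apply_univ]; exact hZ.isBounded.measure_lt_top⟩
  refine (hasDerivAt_integral_of_dominated_loc_of_deriv_le (bound := fun _ => C)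
    (Metric.ball_mem_nhds t hε) ?_ (hZ.integrableOn_of_continuousOn (hf t ht))
    (hZ.integrableOn_of_continuousOn (continuousOn_slice hf' ht)).aestronglyMeasurable
    ?_ (integrable_const _) ?_).2
  · filter_upwards [Metric.ball_mem_nhds t hε] with s hs
    exact (hZ.integrableOn_of_continuousOn (hf s (hball hs))).aestronglyMeasurable
  · filter_upwards [ae_restrict_mem hZ.isOpen.measurableSet] with x hx s hs
    exact hC s hs x (subset_closure hx)
  · filter_upwards [ae_restrict_mem hZ.isOpen.measurableSet] with x hx s hs
    exact hd s (hball hs) x (subset_closure hx)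

theorem IsSmoothBoundedDomain.continuousOn_integral_frontier (hZ : IsSmoothBoundedDomain Z)
    (hI : IsOpen I) {f : ℝ → E3 → ℝ}
    (hf : ContinuousOn (fun q : ℝ × E3 => f q.1 q.2) (I ×ˢ frontier Z)) :
    ContinuousOn (fun t => ∫ x in frontier Z, f t x ∂μHE[2]) I := by
  intro t ht
  obtain ⟨ε, hε, hball, C, hC⟩ := exists_bound_near hI hZ.isCompact_frontier hf ht
  have hfin : IsFiniteMeasure (μHE[2].restrict (frontier Z)) := ⟨by
    rw [Measure.restrict_apply_univ]; exact hZ.measure_frontier_lt_top⟩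
  refine (continuousAt_of_dominated (bound := fun _ => C) ?_ ?_ (integrable_const _)
    ?_).continuousWithinAt
  · filter_upwards [Metric.ball_mem_nhds t hε] with s hs
    exact (hZ.integrableOn_frontier (continuousOn_slice hf (hball hs))).aestronglyMeasurable
  · filter_upwards [Metric.ball_mem_nhds t hε] with s hs
    filter_upwards [ae_restrict_mem isClosed_frontier.measurableSet] with x hx
    exact hC s hs x hx
  · filter_upwards [ae_restrict_mem isClosed_frontier.measurableSet] with x hx
    have h : ContinuousOn (fun s => f s x) I := hf.comp
      (continuous_id.prodMk continuous_const).continuousOn fun s hs => ⟨hs, hx⟩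
    exact h.continuousAt (hI.mem_nhds ht)

end TimeDependence

/-! ### Curl, cross product and storage density in components -/

section Fields

variable {Z : Set E3} {I : Set ℝ}

theorem continuousOn_sharp {X : Type*} [NormedAddCommGroup X] [NormedSpace ℝ X] {α : X → Cov 1}
    {s : Set X} (h : ContDiffOn ℝ 1 α s) : ContinuousOn (fun q => sharp (α q)) s :=
  (PiLp.continuous_toLp 2 _).comp_continuousOn (continuousOn_pi.2 fun i =>
    ((component i).contDiff.comp_contDiffOn h).continuousOn)

theorem storageDensity_eq (ε μ : E3 → ℝ) (h e : E3 → Cov 1) (x : E3) :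
    storageDensity ε μ h e x = 1 / 2 * (μ x * ∑ i, component i (h x) ^ 2 +
      ε x * ∑ i, component i (e x) ^ 2) := by
  rw [storageDensity, coeff3_wedge_star1, coeff3_wedge_star1]
  simp only [sq]

/-- The components of the curl of a one-form. -/
def curlComponent (α : E3 → Cov 1) (x : E3) (i : Fin 3) : ℝ :=
  fderiv ℝ (fun y => component (i + 2) (α y)) x (EuclideanSpace.basisFun (Fin 3) ℝ (i + 1)) -
    fderiv ℝ (fun y => component (i + 1) (α y)) x (EuclideanSpace.basisFun (Fin 3) ℝ (i + 2))

/-- The components of the cross product of two one-forms. -/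
def crossComponent (α β : Cov 1) (i : Fin 3) : ℝ :=
  component (i + 1) α * component (i + 2) β - component (i + 2) α * component (i + 1) β

/-- The identity div(α × β) = β·curl α - α·curl β. -/
theorem sum_fderiv_crossComponent {α β : E3 → Cov 1} {x : E3} (hα : DifferentiableAt ℝ α x)
    (hβ : DifferentiableAt ℝ β x) :
    ∑ i, fderiv ℝ (fun y => crossComponent (α y) (β y) i) x (EuclideanSpace.basisFun (Fin 3) ℝ i) =
      ∑ i, component i (β x) * curlComponent α x i -
        ∑ i, component i (α x) * curlComponent β x i := by
  have ha : ∀ i, DifferentiableAt ℝ (fun y => component i (α y)) x := fun i =>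
    (component i).differentiableAt.comp x hα
  have hb : ∀ i, DifferentiableAt ℝ (fun y => component i (β y)) x := fun i =>
    (component i).differentiableAt.comp x hβ
  have h : ∀ i, fderiv ℝ (fun y => crossComponent (α y) (β y) i) x = _ := fun i =>
    (((ha (i + 1)).hasFDerivAt.mul (hb (i + 2)).hasFDerivAt).sub
      ((ha (i + 2)).hasFDerivAt.mul (hb (i + 1)).hasFDerivAt)).fderiv
  have e1 : (1 : Fin 3) + 2 = 0 := rfl
  have e2 : (2 : Fin 3) + 1 = 0 := rfl
  have e3 : (2 : Fin 3) + 2 = 1 := rfl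
  have e4 : (1 : Fin 3) + 1 = 2 := rfl
  simp only [h, Fin.sum_univ_three, curlComponent, sub_apply, add_apply, smul_apply, smul_eq_mul,
    zero_add, e1, e2, e3, e4]
  ring

theorem sum_crossComponent_mul (α β : Cov 1) (n : E3) :
    ∑ i, crossComponent α β i * inner ℝ n (EuclideanSpace.basisFun (Fin 3) ℝ i) =
      vol3 ![n, sharp α, sharp β] := by
  have e1 : (1 : Fin 3) + 2 = 0 := rfl
  have e2 : (2 : Fin 3) + 1 = 0 := rfl
  have e3 : (2 : Fin 3) + 2 = 1 := rfl
  have e4 : (1 : Fin 3) + 1 = 2 := rfl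
  have hi : ∀ i, inner ℝ n (EuclideanSpace.basisFun (Fin 3) ℝ i) = n i := fun i => by
    rw [EuclideanSpace.basisFun_apply, EuclideanSpace.inner_single_right]
    simp
  have hs : ∀ (θ : Cov 1) i, sharp θ i = component i θ := fun θ i => rfl
  simp only [hi, vol3_apply, hs, Fin.sum_univ_three, crossComponent, zero_add, e1, e2, e3, e4]
  ring

/-- The divergence theorem for the cross product of two one-forms. -/
theorem integral_curl_sub_curl (hZ : IsSmoothBoundedDomain Z) {α β : E3 → Cov 1}
    (hα : ContDiffOn ℝ 1 α (closure Z)) (hβ : ContDiffOn ℝ 1 β (closure Z)) :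
    IntegrableOn (fun x => ∑ i, component i (β x) * curlComponent α x i -
        ∑ i, component i (α x) * curlComponent β x i) Z ∧
    ∫ x in Z, (∑ i, component i (β x) * curlComponent α x i -
        ∑ i, component i (α x) * curlComponent β x i) =
      ∫ x in frontier Z, vol3 ![outwardNormal Z x, sharp (α x), sharp (β x)] ∂μHE[2] := by
  have hreg : ∀ i, HasBoundedGradient Z fun x => crossComponent (α x) (β x) i := fun i =>
    hasBoundedGradient_of_contDiffOn hZ
      ((((component (i + 1)).contDiff.comp_contDiffOn hα).mul
        ((component (i + 2)).contDiff.comp_contDiffOn hβ)).sub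
        (((component (i + 2)).contDiff.comp_contDiffOn hα).mul
        ((component (i + 1)).contDiff.comp_contDiffOn hβ)))
  have hdiff : ∀ {γ : E3 → Cov 1}, ContDiffOn ℝ 1 γ (closure Z) → ∀ x ∈ Z,
      DifferentiableAt ℝ γ x := fun hγ x hx => (hγ.differentiableOn (by simp)).differentiableAt
    (Filter.mem_of_superset (hZ.isOpen.mem_nhds hx) subset_closure)
  have heq : EqOn (fun x => ∑ i, fderiv ℝ (fun y => crossComponent (α y) (β y) i) x
      (EuclideanSpace.basisFun (Fin 3) ℝ i)) (fun x => ∑ i, component i (β x) *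
        curlComponent α x i - ∑ i, component i (α x) * curlComponent β x i) Z := fun x hx =>
    sum_fderiv_crossComponent (hdiff hα x hx) (hdiff hβ x hx)
  have hint : ∀ i ∈ (Finset.univ : Finset (Fin 3)), IntegrableOn (fun x =>
      fderiv ℝ (fun y => crossComponent (α y) (β y) i) x (EuclideanSpace.basisFun (Fin 3) ℝ i)) Z :=
    fun i _ => integrableOn_fderiv_apply hZ (hreg i).bound _
  refine ⟨IntegrableOn.congr_fun (integrable_finsetSum _ hint) heq hZ.isOpen.measurableSet, ?_⟩
  rw [← setIntegral_congr_fun hZ.isOpen.measurableSet heq, integral_finsetSum _ hint,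
    Finset.sum_congr rfl fun i _ => (hreg i).fluxIdentity hZ _,
    ← integral_finsetSum _ fun i _ => (hreg i).integrableOn_flux hZ _]
  simp only [sum_crossComponent_mul]

theorem hasDerivAt_component {α : ℝ → Cov 1} {α' : Cov 1} {t : ℝ} (h : HasDerivAt α α' t)
    (i : Fin 3) : HasDerivAt (fun s => component i (α s)) (component i α') t :=
  (component i).hasFDerivAt.comp_hasDerivAt t h

/-- Time differentiation commutes with the curl at interior points, where `C²` regularity is
available in a full neighbourhood. -/
theorem hasDerivAt_curl (hZ : IsOpen Z) (hI : IsOpen I) {α : ℝ → E3 → Cov 1}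
    (hα : ContDiffOn ℝ 2 (fun q : ℝ × E3 => α q.1 q.2) (I ×ˢ closure Z)) {t : ℝ} (ht : t ∈ I)
    {x : E3} (hx : x ∈ Z) (i : Fin 3) :
    HasDerivAt (fun s => component i (star2 (extDeriv (α s) x)))
      (curlComponent (fun y => deriv (fun s => α s y) t) x i) t := by
  have hxc : closure Z ∈ 𝓝 x := Filter.mem_of_superset (hZ.mem_nhds hx) subset_closure
  have hcomp : ∀ j, ContDiffAt ℝ 2 (fun q : ℝ × E3 => component j (α q.1 q.2)) (t, x) := fun j =>
    ((component j).contDiff.comp_contDiffOn hα).contDiffAt (prod_mem_nhds (hI.mem_nhds ht) hxc)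
  have hder : ∀ j, (fun y => component j (deriv (fun s => α s y) t)) =ᶠ[𝓝 x]
      fun y => deriv (fun s => component j (α s y)) t := by
    intro j
    filter_upwards [hxc] with y hy
    exact (hasDerivAt_component (hasDerivAt_time (by norm_num) hI hα ht hy) j).deriv.symm
  have h := (hasDerivAt_fderiv_time (hcomp (i + 2)) (EuclideanSpace.basisFun (Fin 3) ℝ (i + 1))).sub
    (hasDerivAt_fderiv_time (hcomp (i + 1)) (EuclideanSpace.basisFun (Fin 3) ℝ (i + 2)))
  rw [curlComponent, (hder _).fderiv_eq, (hder _).fderiv_eq]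
  refine h.congr_of_eventuallyEq ?_
  filter_upwards [hI.mem_nhds ht] with s hs
  exact component_curl (((contDiffOn_slice hα hs).differentiableOn (by simp)).differentiableAt hxc) i

end Fields

/-! ### Differentiating the boundary condition in time -/

section BoundaryRate

variable {Z : Set E3} {p : E3} {t : ℝ}

theorem hasDerivAt_clm {E F : Type*} [NormedAddCommGroup E] [NormedSpace ℝ E]
    [NormedAddCommGroup F] [NormedSpace ℝ F] (L : E →L[ℝ] F) {f : ℝ → E} {f' : E}
    (h : HasDerivAt f f' t) : HasDerivAt (fun s => L (f s)) (L f') t :=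
  L.hasFDerivAt.comp_hasDerivAt t h

theorem hasDerivAt_restrictBoundary {α : ℝ → Cov 1} {α' : Cov 1} (h : HasDerivAt α α' t) :
    HasDerivAt (fun s => restrictBoundary Z p (α s)) (restrictBoundary Z p α') t :=
  hasDerivAt_clm (E := Cov 1) (F := tangentPlane Z p [⋀^Fin 1]→L[ℝ] ℝ)
    (ContinuousAlternatingMap.compContinuousLinearMapCLM (tangentPlane Z p).subtypeL) h

theorem hasDerivAt_boundaryStar {α : ℝ → tangentPlane Z p [⋀^Fin 1]→L[ℝ] ℝ}
    {α' : tangentPlane Z p [⋀^Fin 1]→L[ℝ] ℝ} (h : HasDerivAt α α' t) :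
    HasDerivAt (fun s => boundaryStar Z p (α s)) (boundaryStar Z p α') t := by
  have happ : ∀ m, HasDerivAt (fun s => α s m) (α' m) t := fun m =>
    hasDerivAt_clm (E := tangentPlane Z p [⋀^Fin 1]→L[ℝ] ℝ) (F := ℝ)
      (ContinuousAlternatingMap.apply ℝ (tangentPlane Z p) ℝ m) h
  unfold boundaryStar hodgeStar
  refine hasDerivAt_clm (E := tangentPlane Z p [⋀^Fin 1]→L[ℝ] ℝ)
    (F := tangentPlane Z p [⋀^Fin 1]→L[ℝ] ℝ)
    ((Nat.factorial 1 : ℝ)⁻¹ • ContinuousLinearMap.id ℝ _) ?_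
  exact HasDerivAt.fun_sum fun s _ =>
    hasDerivAt_clm (E := ℝ) (F := tangentPlane Z p [⋀^Fin 1]→L[ℝ] ℝ)
      (ContinuousLinearMap.toSpanSingleton ℝ _) (happ _)

theorem hasDerivAt_resistive {h e : ℝ → Cov 1} {h' e' : Cov 1} (hh : HasDerivAt h h' t)
    (he : HasDerivAt e e' t) (c : ℝ) :
    HasDerivAt (fun s => restrictBoundary Z p (h s) +
        boundaryStar Z p (c • restrictBoundary Z p (e s)))
      (restrictBoundary Z p h' + boundaryStar Z p (c • restrictBoundary Z p e')) t :=
  HasDerivAt.fun_add (𝕜 := ℝ) (F := tangentPlane Z p [⋀^Fin 1]→L[ℝ] ℝ)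
    (hasDerivAt_restrictBoundary hh)
    (hasDerivAt_boundaryStar
      (hasDerivAt_clm (E := tangentPlane Z p [⋀^Fin 1]→L[ℝ] ℝ)
        (F := tangentPlane Z p [⋀^Fin 1]→L[ℝ] ℝ) (c • ContinuousLinearMap.id ℝ _)
        (hasDerivAt_restrictBoundary he)))

end BoundaryRate

/-! ### Power balance inside the domain and power supplied at the boundary -/

section Passivity

variable {Z : Set E3} {I : Set ℝ} {ε μ σ σd : E3 → ℝ} {w : Signal Z} {t : ℝ}

theorem contDiffOn_rate (hI : IsOpen I) {α : ℝ → E3 → Cov 1}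
    (hα : ContDiffOn ℝ 2 (fun q : ℝ × E3 => α q.1 q.2) (I ×ˢ closure Z)) :
    ContDiffOn ℝ 1 (fun q : ℝ × E3 => deriv (fun s => α s q.2) q.1) (I ×ˢ closure Z) := by
  have h : ContDiffOn ℝ ((1 : ℕ) + 1) (fun q : ℝ × E3 => α q.1 q.2) (I ×ˢ closure Z) :=
    hα.of_le (by norm_num)
  exact_mod_cast contDiffOn_deriv_time hI h

theorem continuousOn_rate {K : Set E3} (hI : IsOpen I) {α : ℝ → E3 → Cov 1}
    (hα : ContDiffOn ℝ 1 (fun q : ℝ × E3 => α q.1 q.2) (I ×ˢ K)) :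
    ContinuousOn (fun q : ℝ × E3 => deriv (fun s => α s q.2) q.1) (I ×ˢ K) := by
  have h : ContDiffOn ℝ ((0 : ℕ) + 1) (fun q : ℝ × E3 => α q.1 q.2) (I ×ˢ K) :=
    hα.of_le (by norm_num)
  exact (contDiffOn_deriv_time hI h).continuousOn

theorem IsMaxwellSolution.contDiffOn_magneticRate (hw : IsMaxwellSolution Z ε μ σ σd I w)
    (hI : IsOpen I) :
    ContDiffOn ℝ 1 (fun q : ℝ × E3 => w.magneticRate q.1 q.2) (I ×ˢ closure Z) :=
  contDiffOn_rate hI hw.contDiff_magnetic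

theorem IsMaxwellSolution.contDiffOn_electricRate (hw : IsMaxwellSolution Z ε μ σ σd I w)
    (hI : IsOpen I) :
    ContDiffOn ℝ 1 (fun q : ℝ × E3 => w.electricRate q.1 q.2) (I ×ˢ closure Z) :=
  contDiffOn_rate hI hw.contDiff_electric

/-- No regularity of the source is assumed: on the open set `I` the boundary condition identifies it
with a linear expression in the traces of the fields. -/
theorem IsMaxwellSolution.hasDerivAt_source (hw : IsMaxwellSolution Z ε μ σ σd I w)
    (hI : IsOpen I) (ht : t ∈ I) {p : E3} (hp : p ∈ frontier Z) :
    HasDerivAt (fun s => w.source s p) (restrictBoundary Z p (w.magneticRate t p) +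
      boundaryStar Z p (σd p • restrictBoundary Z p (w.electricRate t p))) t := by
  have hpc := frontier_subset_closure hp
  have hr := hasDerivAt_resistive (Z := Z) (p := p)
    (hasDerivAt_time (by norm_num) hI hw.contDiff_magnetic ht hpc)
    (hasDerivAt_time (by norm_num) hI hw.contDiff_electric ht hpc) (σd p)
  refine HasDerivAt.congr_of_eventuallyEq (𝕜 := ℝ) (F := tangentPlane Z p [⋀^Fin 1]→L[ℝ] ℝ)
    hr ?_
  filter_upwards [hI.mem_nhds ht] with s hs
  exact (neg_add_eq_zero.mp (hw.boundary s hs p hp).symm).symm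

/-- The density of the supplied power. -/
def powerDensity (σd : E3 → ℝ) (w : Signal Z) (t : ℝ) (p : E3) : ℝ :=
  vol3 ![outwardNormal Z p, sharp (w.magneticRate t p), sharp (w.electricRate t p)] +
    σd p * (‖sharp (w.electricRate t p)‖ ^ 2 -
      inner ℝ (outwardNormal Z p) (sharp (w.electricRate t p)) ^ 2)

theorem IsMaxwellSolution.boundaryDensity_eq_powerDensity (hZ : IsSmoothBoundedDomain Z)
    (hw : IsMaxwellSolution Z ε μ σ σd I w) (hI : IsOpen I) (ht : t ∈ I) {p : E3}
    (hp : p ∈ frontier Z) :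
    boundaryDensity Z (w.sourceRate t) (w.output t) p = powerDensity σd w t p :=
  boundaryDensity_resistive (hZ.norm_outwardNormal hp) _ _ _ _ _
    (HasDerivAt.deriv (𝕜 := ℝ) (F := tangentPlane Z p [⋀^Fin 1]→L[ℝ] ℝ)
      (hw.hasDerivAt_source hI ht hp)) rfl

theorem IsMaxwellSolution.continuousOn_vol3 (hZ : IsSmoothBoundedDomain Z)
    (hw : IsMaxwellSolution Z ε μ σ σd I w) (hI : IsOpen I) :
    ContinuousOn (fun q : ℝ × E3 => vol3 ![outwardNormal Z q.2, sharp (w.magneticRate q.1 q.2),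
      sharp (w.electricRate q.1 q.2)]) (I ×ˢ frontier Z) := by
  have hsub : I ×ˢ frontier Z ⊆ I ×ˢ closure Z := prod_mono Subset.rfl frontier_subset_closure
  have hn : ContinuousOn (fun q : ℝ × E3 => outwardNormal Z q.2) (I ×ˢ frontier Z) :=
    hZ.continuousOn_outwardNormal.comp continuous_snd.continuousOn fun q hq => hq.2
  have hc : ∀ {v : ℝ × E3 → E3}, ContinuousOn v (I ×ˢ frontier Z) → ∀ i,
      ContinuousOn (fun q => v q i) (I ×ˢ frontier Z) := fun hv i =>
    (EuclideanSpace.proj (𝕜 := ℝ) i).continuous.comp_continuousOn hv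
  have hn' := hc hn
  have hh := hc (continuousOn_sharp ((hw.contDiffOn_magneticRate hI).mono hsub))
  have he := hc (continuousOn_sharp ((hw.contDiffOn_electricRate hI).mono hsub))
  simp only [vol3_apply]
  fun_prop

theorem IsMaxwellSolution.continuousOn_powerDensity (hZ : IsSmoothBoundedDomain Z)
    (hw : IsMaxwellSolution Z ε μ σ σd I w) (hI : IsOpen I) (hσd : ContinuousOn σd (frontier Z)) :
    ContinuousOn (fun q : ℝ × E3 => powerDensity σd w q.1 q.2) (I ×ˢ frontier Z) := by
  have hn : ContinuousOn (fun q : ℝ × E3 => outwardNormal Z q.2) (I ×ˢ frontier Z) :=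
    hZ.continuousOn_outwardNormal.comp continuous_snd.continuousOn fun q hq => hq.2
  have hs : ContinuousOn (fun q : ℝ × E3 => σd q.2) (I ×ˢ frontier Z) :=
    hσd.comp continuous_snd.continuousOn fun q hq => hq.2
  have he := continuousOn_sharp ((hw.contDiffOn_electricRate hI).mono
    (prod_mono (Subset.refl I) (frontier_subset_closure (s := Z))))
  exact (hw.continuousOn_vol3 hZ hI).add (hs.mul ((he.norm.pow 2).sub ((hn.inner he).pow 2)))

theorem IsMaxwellSolution.boundaryPairing_eq (hZ : IsSmoothBoundedDomain Z)
    (hw : IsMaxwellSolution Z ε μ σ σd I w) (hI : IsOpen I) (ht : t ∈ I) :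
    boundaryPairing Z (w.sourceRate t) (w.output t) =
      ∫ p in frontier Z, powerDensity σd w t p ∂μHE[2] :=
  setIntegral_congr_fun isClosed_frontier.measurableSet fun _ hp =>
    hw.boundaryDensity_eq_powerDensity hZ hI ht hp

/-- At a fixed interior point both field equations hold for all times near `t`, so both sides have
equal time derivatives. The resulting identities for the rates are paired with `-ℋ_t` and `ℰ_t` and
added. -/
theorem IsMaxwellSolution.power_balance (hZ : IsSmoothBoundedDomain Z)
    (hw : IsMaxwellSolution Z ε μ σ σd I w) (hI : IsOpen I) (ht : t ∈ I) {x : E3} (hx : x ∈ Z) :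
    μ x * ∑ i, component i (w.magneticRate t x) *
        component i (deriv (fun s => w.magneticRate s x) t) +
      ε x * ∑ i, component i (w.electricRate t x) *
        component i (deriv (fun s => w.electricRate s x) t) =
    (∑ i, component i (w.electricRate t x) * curlComponent (w.magneticRate t) x i -
      ∑ i, component i (w.magneticRate t x) * curlComponent (w.electricRate t) x i) -
      σ x * ∑ i, component i (w.electricRate t x) ^ 2 := by
  have hxc := subset_closure hx
  have hH := hasDerivAt_time le_rfl hI (hw.contDiffOn_magneticRate hI) ht hxc
  have hE := hasDerivAt_time le_rfl hI (hw.contDiffOn_electricRate hI) ht hxc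
  have hE1 := hasDerivAt_time (by norm_num) hI hw.contDiff_electric ht hxc
  have hfar : ∀ i, -(μ x * component i (deriv (fun s => w.magneticRate s x) t)) =
      curlComponent (w.electricRate t) x i := fun i => by
    refine (((hasDerivAt_component hH i).const_mul (μ x)).fun_neg.congr_of_eventuallyEq ?_).unique
      ((hasDerivAt_curl hZ.isOpen hI hw.contDiff_electric ht hx i))
    filter_upwards [hI.mem_nhds ht] with s hs
    rw [← hw.faraday s hs x hx]
    simp
  have hamp : ∀ i, ε x * component i (deriv (fun s => w.electricRate s x) t) =
      -(σ x * component i (w.electricRate t x)) + curlComponent (w.magneticRate t) x i :=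
    fun i => by
    refine ((hasDerivAt_component hE i).const_mul (ε x)).unique
      ((((hasDerivAt_component hE1 i).const_mul (σ x)).fun_neg.fun_add
        (hasDerivAt_curl hZ.isOpen hI hw.contDiff_magnetic ht hx i)).congr_of_eventuallyEq ?_)
    filter_upwards [hI.mem_nhds ht] with s hs
    have := congrArg (component i) (hw.ampere s hs x hx)
    simpa using this
  simp only [Finset.mul_sum, ← Finset.sum_add_distrib, ← Finset.sum_sub_distrib]
  refine Finset.sum_congr rfl fun i _ => ?_
  linear_combination (-component i (w.magneticRate t x)) * hfar i +
    component i (w.electricRate t x) * hamp i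

end Passivity

/-! ### Derivative of the storage and the dissipation inequality -/

section Storage

variable {Z : Set E3} {I : Set ℝ} {ε μ σ σd : E3 → ℝ} {w : Signal Z} {t : ℝ}

theorem continuousOn_storageDensity {X : Type*} [TopologicalSpace X] {K : Set X} {a b : X → ℝ}
    {h h' e e' : X → Cov 1} (ha : ContinuousOn a K) (hb : ContinuousOn b K)
    (hh : ContinuousOn h K) (hh' : ContinuousOn h' K) (he : ContinuousOn e K)
    (he' : ContinuousOn e' K) :
    ContinuousOn (fun x => a x * ∑ i, component i (h x) * component i (h' x) +
      b x * ∑ i, component i (e x) * component i (e' x)) K := by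
  have hc : ∀ {α : X → Cov 1}, ContinuousOn α K → ∀ i,
      ContinuousOn (fun x => component i (α x)) K := fun hα i =>
    (component i).continuous.comp_continuousOn hα
  exact (ha.mul (continuousOn_finsetSum _ fun i _ => (hc hh i).mul (hc hh' i))).add
    (hb.mul (continuousOn_finsetSum _ fun i _ => (hc he i).mul (hc he' i)))

theorem IsMaxwellSolution.continuousOn_storage (hw : IsMaxwellSolution Z ε μ σ σd I w)
    (hI : IsOpen I) (hε : ContinuousOn ε (closure Z)) (hμ : ContinuousOn μ (closure Z))
    (ht : t ∈ I) :
    ContinuousOn (storageDensity ε μ (w.magneticRate t) (w.electricRate t)) (closure Z) := by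
  have hh := (contDiffOn_slice (hw.contDiffOn_magneticRate hI) ht).continuousOn
  have he := (contDiffOn_slice (hw.contDiffOn_electricRate hI) ht).continuousOn
  refine (continuousOn_const (c := (1 / 2 : ℝ)).mul
    (continuousOn_storageDensity hμ hε hh hh he he)).congr fun x _ => ?_
  simp only [storageDensity_eq, sq]
  rfl

theorem hasDerivAt_storageDensity {h e : ℝ → E3 → Cov 1} {h' e' : Cov 1} {x : E3}
    (hh : HasDerivAt (fun s => h s x) h' t) (he : HasDerivAt (fun s => e s x) e' t) :
    HasDerivAt (fun s => storageDensity ε μ (h s) (e s) x)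
      (μ x * ∑ i, component i (h t x) * component i h' +
        ε x * ∑ i, component i (e t x) * component i e') t := by
  have hs : ∀ {α : ℝ → E3 → Cov 1} {α' : Cov 1}, HasDerivAt (fun s => α s x) α' t →
      HasDerivAt (fun s => ∑ i, component i (α s x) ^ 2)
        (∑ i, 2 * (component i (α t x) * component i α')) t := fun hα =>
    HasDerivAt.fun_sum fun i _ =>
      ((hasDerivAt_component hα i).fun_pow 2).congr_deriv (by push_cast; ring)
  simp only [storageDensity_eq]
  refine ((((hs hh).const_mul (μ x)).fun_add ((hs he).const_mul (ε x))).const_mul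
    (1 / 2)).congr_deriv ?_
  rw [← Finset.mul_sum, ← Finset.mul_sum]
  ring

/-- The power dissipated in the medium is subtracted from the flux through the boundary. -/
theorem IsMaxwellSolution.hasDerivAt_storage (hZ : IsSmoothBoundedDomain Z)
    (hw : IsMaxwellSolution Z ε μ σ σd I w) (hI : IsOpen I) (hε : ContinuousOn ε (closure Z))
    (hμ : ContinuousOn μ (closure Z)) (hσ : ContinuousOn σ (closure Z)) (ht : t ∈ I) :
    HasDerivAt (fun s => storage Z ε μ (w.magneticRate s) (w.electricRate s))
      (∫ x in frontier Z, vol3 ![outwardNormal Z x, sharp (w.magneticRate t x),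
          sharp (w.electricRate t x)] ∂μHE[2] -
        ∫ x in Z, σ x * ∑ i, component i (w.electricRate t x) ^ 2) t := by
  have hh := hw.contDiffOn_magneticRate hI
  have he := hw.contDiffOn_electricRate hI
  have hp : ∀ {c : E3 → ℝ}, ContinuousOn c (closure Z) →
      ContinuousOn (fun q : ℝ × E3 => c q.2) (I ×ˢ closure Z) := fun hc =>
    hc.comp continuous_snd.continuousOn fun q hq => hq.2
  have hder := hZ.hasDerivAt_integral hI
    (f := fun s => storageDensity ε μ (w.magneticRate s) (w.electricRate s))
    (fun s hs => hw.continuousOn_storage hI hε hμ hs)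
    (continuousOn_storageDensity (hp hμ) (hp hε) hh.continuousOn (continuousOn_rate hI hh)
      he.continuousOn (continuousOn_rate hI he))
    (fun s hs x hx => hasDerivAt_storageDensity (hasDerivAt_time le_rfl hI hh hs hx)
      (hasDerivAt_time le_rfl hI he hs hx)) ht
  have hh' := contDiffOn_slice hh ht
  have he' := contDiffOn_slice he ht
  obtain ⟨hint, hflux⟩ := integral_curl_sub_curl hZ hh' he'
  have hdiss : IntegrableOn (fun x => σ x * ∑ i, component i (w.electricRate t x) ^ 2) Z :=
    hZ.integrableOn_of_continuousOn (hσ.mul (continuousOn_finsetSum _ fun i _ =>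
      ((component i).continuous.comp_continuousOn he'.continuousOn).pow 2))
  refine hder.congr_deriv ?_
  rw [← hflux, ← integral_sub hint hdiss]
  exact setIntegral_congr_fun hZ.isOpen.measurableSet fun x hx => hw.power_balance hZ hI ht hx

theorem IsMaxwellSolution.integrableOn_powerDensity (hZ : IsSmoothBoundedDomain Z)
    (hw : IsMaxwellSolution Z ε μ σ σd I w) (hI : IsOpen I) (hσd : ContinuousOn σd (frontier Z))
    (ht : t ∈ I) : IntegrableOn (powerDensity σd w t) (frontier Z) μHE[2] :=
  hZ.integrableOn_frontier (continuousOn_slice (hw.continuousOn_powerDensity hZ hI hσd) ht)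

/-- The gap between the sides is volume dissipation through `σ` plus surface dissipation through
`σd`. The latter is nonnegative by Cauchy–Schwarz with the unit normal. -/
theorem IsMaxwellSolution.dissipation_inequality (hZ : IsSmoothBoundedDomain Z)
    (hw : IsMaxwellSolution Z ε μ σ σd I w) (hI : IsOpen I) (hσ0 : ∀ x ∈ closure Z, 0 ≤ σ x)
    (hσd : ContinuousOn σd (frontier Z)) (hσd0 : ∀ p ∈ frontier Z, 0 ≤ σd p) (ht : t ∈ I) :
    ∫ x in frontier Z, vol3 ![outwardNormal Z x, sharp (w.magneticRate t x),
        sharp (w.electricRate t x)] ∂μHE[2] -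
      ∫ x in Z, σ x * ∑ i, component i (w.electricRate t x) ^ 2 ≤
    boundaryPairing Z (w.sourceRate t) (w.output t) := by
  have h1 : 0 ≤ ∫ x in Z, σ x * ∑ i, component i (w.electricRate t x) ^ 2 :=
    setIntegral_nonneg hZ.isOpen.measurableSet fun x hx =>
      mul_nonneg (hσ0 x (subset_closure hx)) (Finset.sum_nonneg fun i _ => sq_nonneg _)
  have h2 : ∫ x in frontier Z, vol3 ![outwardNormal Z x, sharp (w.magneticRate t x),
      sharp (w.electricRate t x)] ∂μHE[2] ≤ ∫ x in frontier Z, powerDensity σd w t x ∂μHE[2] := by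
    refine setIntegral_mono_on (hZ.integrableOn_frontier
      (continuousOn_slice (f := fun s x => vol3 ![outwardNormal Z x, sharp (w.magneticRate s x),
        sharp (w.electricRate s x)]) (hw.continuousOn_vol3 hZ hI) ht))
      (hw.integrableOn_powerDensity hZ hI hσd ht) isClosed_frontier.measurableSet fun x hx => ?_
    refine le_add_of_nonneg_right (mul_nonneg (hσd0 x hx) (sub_nonneg.mpr ?_))
    have := abs_real_inner_le_norm (outwardNormal Z x) (sharp (w.electricRate t x))
    rw [hZ.norm_outwardNormal hx, one_mul] at this
    exact sq_le_sq' (neg_le_of_abs_le this) (le_of_abs_le this)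
  rw [hw.boundaryPairing_eq hZ hI ht]
  linarith

theorem IsMaxwellSolution.continuousOn_boundaryPairing (hZ : IsSmoothBoundedDomain Z)
    (hw : IsMaxwellSolution Z ε μ σ σd I w) (hI : IsOpen I) (hσd : ContinuousOn σd (frontier Z)) :
    ContinuousOn (fun s => boundaryPairing Z (w.sourceRate s) (w.output s)) I :=
  (hZ.continuousOn_integral_frontier hI (hw.continuousOn_powerDensity hZ hI hσd)).congr
    fun _ hs => hw.boundaryPairing_eq hZ hI hs

theorem storage_nonneg (hZ : IsOpen Z) (hε : ∀ x ∈ closure Z, 0 < ε x)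
    (hμ : ∀ x ∈ closure Z, 0 < μ x) (h e : E3 → Cov 1) : 0 ≤ storage Z ε μ h e := by
  refine setIntegral_nonneg hZ.measurableSet fun x hx => ?_
  have h1 := hε x (subset_closure hx)
  have h2 := hμ x (subset_closure hx)
  rw [storageDensity_eq]
  positivity

theorem IsMaxwellSolution.differentiableAt_source (hw : IsMaxwellSolution Z ε μ σ σd I w)
    (hI : IsOpen I) (ht : t ∈ I) {p : E3} (hp : p ∈ frontier Z) :
    DifferentiableAt ℝ (fun s => w.source s p) t :=
  HasDerivAt.differentiableAt (𝕜 := ℝ) (F := tangentPlane Z p [⋀^Fin 1]→L[ℝ] ℝ)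
    (hw.hasDerivAt_source hI ht hp)

end Storage

end MaxwellBoundary

end

/-! ### Passivity of the boundary-controlled Maxwell system -/

theorem mainTheorem10
    (Z : Set MaxwellBoundary.E3) (hZ : MaxwellBoundary.IsSmoothBoundedDomain Z)
    (ε μ σ σd : MaxwellBoundary.E3 → ℝ)
    (hε : ContinuousOn ε (closure Z)) (hε_pos : ∀ x ∈ closure Z, 0 < ε x)
    (hμ : ContinuousOn μ (closure Z)) (hμ_pos : ∀ x ∈ closure Z, 0 < μ x)
    (hσ : ContinuousOn σ (closure Z)) (hσ_nonneg : ∀ x ∈ closure Z, 0 ≤ σ x)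
    (hσd : ContinuousOn σd (frontier Z)) (hσd_nonneg : ∀ p ∈ frontier Z, 0 ≤ σd p)
    (I : Set ℝ) (hI_open : IsOpen I) (hI_interval : I.OrdConnected) :
    MaxwellBoundary.IsPassive I
      {w : MaxwellBoundary.Signal Z | MaxwellBoundary.IsMaxwellSolution Z ε μ σ σd I w}
      (fun w t => MaxwellBoundary.storage Z ε μ (w.magneticRate t) (w.electricRate t))
      (fun w t => w.sourceRate t)
      (fun w t => w.output t)
      (MaxwellBoundary.boundaryPairing Z) ∧
    ∀ w : MaxwellBoundary.Signal Z, MaxwellBoundary.IsMaxwellSolution Z ε μ σ σd I w →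
      ∀ t ∈ I,
        IntegrableOn
          (MaxwellBoundary.storageDensity ε μ (w.magneticRate t) (w.electricRate t)) Z ∧
        (∀ p ∈ frontier Z, DifferentiableAt ℝ (fun s => w.source s p) t) ∧
        IntegrableOn
          (MaxwellBoundary.boundaryDensity Z (w.sourceRate t) (w.output t)) (frontier Z)
          (Measure.euclideanHausdorffMeasure 2) := by
  refine ⟨fun w hw => ?_, fun w hw t ht => ?_⟩
  · have hd := fun t ht => hw.hasDerivAt_storage (t := t) hZ hI_open hε hμ hσ ht
    have hle := fun t ht => hw.dissipation_inequality (t := t) hZ hI_open hσ_nonneg hσd hσd_nonneg ht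
    have hc := hw.continuousOn_boundaryPairing hZ hI_open hσd
    refine ⟨fun t _ => MaxwellBoundary.storage_nonneg hZ.isOpen hε_pos hμ_pos _ _,
      fun t ht => ⟨(hd t ht).differentiableAt, (hd t ht).deriv.trans_le (hle t ht)⟩,
      fun t₀ h₀ t₁ h₁ h01 => ?_⟩
    have hsub : Icc t₀ t₁ ⊆ I := hI_interval.out h₀ h₁
    have hc' := hc.mono hsub
    refine ⟨hc'.intervalIntegrable_of_Icc h01, ?_⟩
    -- This form of the fundamental theorem asks for integrability of the upper bound only, here the
    -- continuous supplied power, and not of the derivative of the storage.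
    exact intervalIntegral.sub_le_integral_of_hasDeriv_right_of_le h01
      (fun t ht => (hd t (hsub ht)).continuousAt.continuousWithinAt)
      (fun t ht => (hd t (hsub (Ioo_subset_Icc_self ht))).hasDerivWithinAt)
      (hc'.integrableOn_compact isCompact_Icc)
      (fun t ht => hle t (hsub (Ioo_subset_Icc_self ht)))
  · exact ⟨hZ.integrableOn_of_continuousOn (hw.continuousOn_storage hI_open hε hμ ht),
      fun p hp => hw.differentiableAt_source hI_open ht hp,
      (hw.integrableOn_powerDensity hZ hI_open hσd ht).congr_fun
        (fun p hp => (hw.boundaryDensity_eq_powerDensity hZ hI_open ht hp).symm)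
        isClosed_frontier.measurableSet⟩
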